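/- Consider $K$ parallel channels with i.i.d. states $S_1,\dots,S_K$ of a common law. For a per-channel power $\gamma>0$ let $J(\gamma,s)$ be the mutual information (in nats) between the input and the output of one channel, for the prescribed input law of power $\gamma$, given the state $s$. For a total power $\rho>0$ and a target rate $r>0$ put $R(K,\rho)=\sum_{k=1}^K J(\rho/K,S_k)$. The wideband outage exponent at energy per nat $\eta=\rho/r$ is $$\mathcal E(\eta)=\lim_{K\to\infty}\frac{-\log \Pr[R(K,\rho)\le r]}{K},$$ and the wideband minimum energy per nat is $\bar\eta=1/\mathbf E[\dot J(0,S_1)]$ with $\dot J(0,s)=\lim_{\gamma\downarrow0}J(\gamma,s)/\gamma$. (a) (Nakagami-$m$ fading.) Let the channels be $Y_k=H_kX_k+Z_k$ with state $H_k\in\mathbb C$, $Z_k\sim\mathcal{CN}(0,1)$, $X_k\sim\mathcal{CN}(0,\rho/K)$, where $|H_k|^2$ is Gamma distributed with shape $m\ge 1/2$ and scale $1/m$. Then $\bar\eta=1$ and, for every $\eta\ge1$, the limit $\mathcal E(\eta)$ exists, depends on $\rho,r$ only through $\eta=\rho/r$, and $$\mathcal E(\eta)=m\left[\frac1\eta-1+\log\eta\right].$$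 This is $m$ times the exponent of Rayleigh fading at the same $\eta$. (b) (Rayleigh fading.) If $H_k\sim\mathcal{CN}(0,1)$, then $|H_k|^2$ is Gamma distributed with shape $1$ and scale $1$, that is, this is the case $m=1$, and $\mathcal E(\eta)=\frac1\eta-1+\log\eta$ for every $\eta\ge1$. (c) (Spatially white Rayleigh fading with several antennas, white inputs.) Let $n_{\mathrm t},n_{\mathrm r}\ge1$ and let the channels be $\mathbf Y_k=\mathbf H_k\mathbf X_k+\mathbf Z_k$, where the state $\mathbf H_k\in\mathbb C^{n_{\mathrm r}\times n_{\mathrm t}}$ has i.i.d. $\mathcal{CN}(0,1)$ entries, $\mathbf Z_k\sim\mathcal{CN}(\mathbf 0,\mathbf I)$ and $\mathbf X_k\sim\mathcal{CN}(\mathbf 0,\frac{\rho}{n_{\mathrm t}K}\mathbf I)$. Then $\bar\eta=1/n_{\mathrm r}$ and, for every $\eta\ge 1/n_{\mathrm r}$, $$\mathcal E(\eta)=n_{\mathrm t}n_{\mathrm r}\left[\frac1{n_{\mathrm r}\eta}-1+\log(n_{\mathrm r}\eta)\right],$$ which is $n_{\mathrm t}n_{\mathrm r}$ times the scalar Rayleigh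 exponent at energy per nat $n_{\mathrm r}\eta$. -/

import Mathlib

open MeasureTheory ProbabilityTheory Filter Topology
open scoped ENNReal NNReal

namespace WidebandOutage

noncomputable section

/-- The law `CN(0, v)` of a circular-symmetric complex Gaussian variable `W` with `E|W|² = v`:
its real and imaginary parts are independent real Gaussians `N(0, v/2)`. -/
def circularGaussian (v : ℝ≥0) : Measure ℂ :=
  ((gaussianReal 0 (v / 2)).prod (gaussianReal 0 (v / 2))).map
    Complex.measurableEquivRealProd.symm

/-- The law of a vector with i.i.d. `CN(0, v)` entries, i.e. `CN(0, v I)`. -/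
def circularGaussianVec (n : ℕ) (v : ℝ≥0) : Measure (Fin n → ℂ) :=
  Measure.pi fun _ => circularGaussian v

/-- The mutual information `I(X; Y)`, in nats, of a pair with joint law `P`: the relative entropy
of the joint law with respect to the product of its marginals. -/
def mutualInfo {α β : Type*} [MeasurableSpace α] [MeasurableSpace β]
    (P : Measure (α × β)) : ℝ≥0∞ :=
  InformationTheory.klDiv P (P.fst.prod P.snd)

/-- The joint law of `(X, Y)`, `Y = f X + Z`, for independent `X ∼ μX` and `Z ∼ μZ`. -/
def inputOutputLaw {α β : Type*} [MeasurableSpace α] [MeasurableSpace β] [Add β]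
    (μX : Measure α) (μZ : Measure β) (f : α → β) : Measure (α × β) :=
  (μX.prod μZ).map fun p => (p.1, f p.1 + p.2)

/-- `J(γ, h)` for the scalar channel `Y = h X + Z` with noise `Z ∼ CN(0, 1)` and
input `X ∼ CN(0, γ)`, given the fading coefficient `h`. -/
def scalarRate (γ : ℝ≥0) (h : ℂ) : ℝ≥0∞ :=
  mutualInfo (inputOutputLaw (circularGaussian γ) (circularGaussian 1) fun x => h * x)

/-- `J(γ, H)` for the multiple-antenna channel `Y = H X + Z` with noise `Z ∼ CN(0, I)` and
spatially white input `X ∼ CN(0, (γ / nt) I)`, given the fading matrix `H`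
(with entry `H i j` in row `i` and column `j`). -/
def mimoRate {nr nt : ℕ} (γ : ℝ≥0) (H : Fin nr → Fin nt → ℂ) : ℝ≥0∞ :=
  mutualInfo (inputOutputLaw (circularGaussianVec nt (γ / nt)) (circularGaussianVec nr 1)
    fun x => (Matrix.of H).mulVec x)

/-- The law of an `nr × nt` fading matrix with i.i.d. `CN(0, 1)` entries. -/
def whiteRayleigh (nr nt : ℕ) : Measure (Fin nr → Fin nt → ℂ) :=
  Measure.pi fun _ : Fin nr => Measure.pi fun _ : Fin nt => circularGaussian 1

/-- `ν` is the law of a normalized Nakagami-`m` fading coefficient `H`: the variable `|H|²` has the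
Gamma distribution with shape `m` and scale `1 / m` (i.e. rate `m`). The phase is arbitrary. -/
def IsNakagami (m : ℝ) (ν : Measure ℂ) : Prop :=
  ν.map (fun h => ‖h‖ ^ 2) = gammaMeasure m m

section General

variable {S : Type*} [MeasurableSpace S]

/-- The outage probability `Pr[R(K, ρ) ≤ r]`, where `R(K, ρ) = ∑ k, J(ρ / K, S k)` and
`S 1, …, S K` are i.i.d. with law `ν`. -/
def outageProb (J : ℝ≥0 → S → ℝ≥0∞) (ν : Measure S) (K : ℕ) (ρ r : ℝ≥0) : ℝ≥0∞ :=
  Measure.pi (fun _ : Fin K => ν) {s | ∑ k, J (ρ / K) (s k) ≤ r}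

/-- `e` is the wideband outage exponent at energy per nat `η`: whenever `ρ / r = η`,
`-log (outage probability) / K` converges to `e` as `K → ∞`. -/
def HasOutageExponent (J : ℝ≥0 → S → ℝ≥0∞) (ν : Measure S) (η : ℝ) (e : EReal) : Prop :=
  ∀ ρ r : ℝ≥0, 0 < ρ → 0 < r → (ρ : ℝ) / r = η →
    Tendsto (fun K : ℕ => -ENNReal.log (outageProb J ν K ρ r) / (K : EReal)) atTop (𝓝 e)

/-- `e` is the wideband minimum energy per nat `1 / E[D(S)]`, where
`D(s) = lim J(γ, s) / γ` as `γ ↓ 0` (in particular, these limits exist). -/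
def HasMinEnergyPerNat (J : ℝ≥0 → S → ℝ≥0∞) (ν : Measure S) (e : ℝ≥0∞) : Prop :=
  ∃ D : S → ℝ≥0∞, (∀ s, Tendsto (fun γ : ℝ≥0 => J γ s / γ) (𝓝[>] 0) (𝓝 (D s))) ∧
    (∫⁻ s, D s ∂ν)⁻¹ = e

end General

end

end WidebandOutage

open WidebandOutage

/-! At power `ρ / K` each channel is in the linear regime of its mutual information: `J γ s` is `γ *
g s` up to a quadratic error, with `g` equal to `|h|²` or to the squared Frobenius norm of `H`
divided by `nt`. Outage is thus asymptotically the event that the empirical mean of the `g (S k)` is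
at most `r / ρ = 1 / η`. In all cases `g (S)` has a Gamma law, of shape `a` and rate `b`, and the
exponent is Cramér's rate function of that law at `1 / η`, namely `a * (b / (a * η) - 1 + log (a * η
/ b))`. The minimum energy per nat is the inverse of the mean `a / b`.

`IsLowPowerRate.hasOutageExponent` proves this without a general large-deviation theorem. The outage
probability is bounded above by Chernoff's inequality at the optimal tilt, applied to a quadratic
minorant of the rate. It is bounded below by using `J γ s ≤ γ * g s`: the sum of the `g (S k)` is
exactly Gamma of shape `K * a`, and its distribution function is estimated with a Stirling bound.

The two bounds on `J` avoid the log-determinant formula for Gaussian channels. Above,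
`mutualInfo_inputOutputLaw_le` replaces the output law by the noise law, at the cost of increasing
the divergence to the mean received energy. Below, `le_mutualInfo_inputOutputLaw` applies the
Donsker–Varadhan inequality to the log-density of the shifted noise; the loss is an exponential
correlation of two independent inputs, of second order in the power. -/

/-! ### Gamma distributions -/

section Gamma

lemma measurable_gammaPDF (a b : ℝ) : Measurable (gammaPDF a b) :=
  (measurable_gammaPDFReal a b).ennreal_ofReal

lemma lintegral_gammaMeasure (a b : ℝ) {f : ℝ → ℝ≥0∞} (hf : Measurable f) :
    ∫⁻ x, f x ∂gammaMeasure a b = ∫⁻ x, gammaPDF a b x * f x := by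
  rw [gammaMeasure, lintegral_withDensity_eq_lintegral_mul _
    (measurable_gammaPDF a b) hf]
  rfl

/-- Exponential tilting keeps the shape of a Gamma law and lowers its rate by `t`; the constant is
the ratio of the normalizations. -/
lemma gammaPDF_mul_exp {a b t : ℝ} (hb : 0 < b) (ht : t < b) (x : ℝ) :
    gammaPDF a b x * ENNReal.ofReal (Real.exp (t * x)) =
      ENNReal.ofReal ((b / (b - t)) ^ a) * gammaPDF a (b - t) x := by
  have hbt : 0 < b - t := sub_pos.2 ht
  rcases lt_or_ge x 0 with hx | hx
  · simp [gammaPDF_of_neg hx]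
  · rw [gammaPDF_of_nonneg hx, gammaPDF_of_nonneg hx, ← ENNReal.ofReal_mul' (by positivity),
      ← ENNReal.ofReal_mul (by positivity), Real.div_rpow hb.le hbt.le]
    congr 1
    have h : Real.exp (-((b - t) * x)) = Real.exp (-(b * x)) * Real.exp (t * x) := by
      rw [← Real.exp_add]; ring_nf
    rw [h]
    have : (b - t) ^ a ≠ 0 := (Real.rpow_pos_of_pos hbt a).ne'
    field_simp

/-- The moment generating function of a Gamma distribution. -/
lemma lintegral_exp_gammaMeasure {a b t : ℝ} (ha : 0 < a) (hb : 0 < b) (ht : t < b) :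
    ∫⁻ x, ENNReal.ofReal (Real.exp (t * x)) ∂gammaMeasure a b =
      ENNReal.ofReal ((b / (b - t)) ^ a) := by
  rw [lintegral_gammaMeasure _ _ (by fun_prop)]
  simp_rw [gammaPDF_mul_exp hb ht]
  rw [lintegral_const_mul' _ _ ENNReal.ofReal_ne_top,
    lintegral_gammaPDF_eq_one ha (sub_pos.2 ht), mul_one]

/-- The mean of a Gamma distribution. -/
lemma lintegral_ofReal_gammaMeasure {a b : ℝ} (ha : 0 < a) (hb : 0 < b) :
    ∫⁻ x, ENNReal.ofReal x ∂gammaMeasure a b = ENNReal.ofReal (a / b) := by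
  rw [lintegral_gammaMeasure _ _ ENNReal.measurable_ofReal]
  -- Size-biasing raises the shape by one, so the mean is the ratio of two normalizing constants.
  have h (x : ℝ) : gammaPDF a b x * ENNReal.ofReal x =
      ENNReal.ofReal (a / b) * gammaPDF (a + 1) b x := by
    rcases lt_or_ge x 0 with hx | hx
    · simp [gammaPDF_of_neg hx]
    · have hΓ : 0 < Real.Gamma a := Real.Gamma_pos_of_pos ha
      rw [gammaPDF_of_nonneg hx, gammaPDF_of_nonneg hx, ← ENNReal.ofReal_mul' hx,
        ← ENNReal.ofReal_mul (by positivity)]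
      congr 1
      rw [Real.Gamma_add_one ha.ne', Real.rpow_add hb, Real.rpow_one]
      rcases hx.eq_or_lt with rfl | hx
      · simp [ha.ne']
      · rw [Real.rpow_sub_one hx.ne', add_sub_cancel_right]
        field_simp
  simp_rw [h]
  rw [lintegral_const_mul' _ _ ENNReal.ofReal_ne_top,
    lintegral_gammaPDF_eq_one (by positivity) hb, mul_one]

/-- Probability measures on the line are determined by their moment generating functions, if these
are finite to the left of some positive number. -/
lemma ext_of_lintegral_exp_eq {μ μ' : Measure ℝ} [IsProbabilityMeasure μ]
    [IsProbabilityMeasure μ'] {b : ℝ} (hb : 0 < b)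
    (h : ∀ t < b, ∫⁻ x, ENNReal.ofReal (Real.exp (t * x)) ∂μ =
      ∫⁻ x, ENNReal.ofReal (Real.exp (t * x)) ∂μ')
    (hfin : ∀ t < b, ∫⁻ x, ENNReal.ofReal (Real.exp (t * x)) ∂μ ≠ ∞) : μ = μ' := by
  have hint {ρ : Measure ℝ} (hρ : ∀ t < b, ∫⁻ x, ENNReal.ofReal (Real.exp (t * x)) ∂ρ ≠ ∞) :
      Set.Iio b ⊆ interior (integrableExpSet id ρ) := by
    refine isOpen_Iio.subset_interior_iff.2 fun t ht => ⟨by fun_prop, ?_⟩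
    rw [hasFiniteIntegral_iff_ofReal (ae_of_all _ fun x => (Real.exp_pos _).le)]
    exact (hρ t ht).lt_top
  have hμ := hint hfin
  have hμ' := hint (fun t ht => h t ht ▸ hfin t ht)
  have hpre (ρ : Measure ℝ) (hρ : Set.Iio b ⊆ interior (integrableExpSet id ρ)) :
      AnalyticOnNhd ℂ (complexMGF id ρ) {z | z.re < b} :=
    analyticOnNhd_complexMGF.mono fun z hz => hρ hz
  -- Both transforms are analytic on a half-plane, which is convex, and agree at real points
  -- accumulating at `0`. By the identity theorem they agree on the imaginary axis too, where they
  -- are the characteristic functions.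
  have heq : Set.EqOn (complexMGF id μ) (complexMGF id μ') {z | z.re < b} := by
    refine AnalyticOnNhd.eqOn_of_preconnected_of_frequently_eq (hpre μ hμ) (hpre μ' hμ')
      (convex_halfSpace_re_lt b).isPreconnected (z₀ := 0) (by simpa using hb) ?_
    have hfr : ∀ᶠ x : ℝ in 𝓝[≠] 0, complexMGF id μ x = complexMGF id μ' x := by
      filter_upwards [nhdsWithin_le_nhds (Iio_mem_nhds hb)] with t ht
      rw [complexMGF_ofReal, complexMGF_ofReal, mgf, mgf,
        integral_eq_lintegral_of_nonneg_ae (ae_of_all _ fun x => (Real.exp_pos _).le)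
          (by fun_prop),
        integral_eq_lintegral_of_nonneg_ae (ae_of_all _ fun x => (Real.exp_pos _).le)
          (by fun_prop)]
      simp only [id_eq]
      rw [h t ht]
    have ht : Tendsto (fun x : ℝ => (x : ℂ)) (𝓝[≠] 0) (𝓝[≠] 0) := by
      refine tendsto_nhdsWithin_iff.2 ⟨?_, ?_⟩
      · exact (Complex.continuous_ofReal.tendsto' 0 0 (by simp)).mono_left nhdsWithin_le_nhds
      · filter_upwards [self_mem_nhdsWithin] with x hx
        simpa using hx
    exact ht.frequently hfr.frequently
  refine Measure.ext_of_charFun ?_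
  ext t
  rw [← complexMGF_id_mul_I, ← complexMGF_id_mul_I]
  exact heq (by simpa using hb)

/-- A probability measure with the moment generating function of a Gamma law is that Gamma law. -/
lemma eq_gammaMeasure_of_lintegral_exp {μ : Measure ℝ} [IsProbabilityMeasure μ] {a b : ℝ}
    (ha : 0 < a) (hb : 0 < b)
    (h : ∀ t < b, ∫⁻ x, ENNReal.ofReal (Real.exp (t * x)) ∂μ =
      ENNReal.ofReal ((b / (b - t)) ^ a)) : μ = gammaMeasure a b := by
  have := isProbabilityMeasure_gammaMeasure ha hb
  refine ext_of_lintegral_exp_eq hb (fun t ht => ?_) (fun t ht => ?_)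
  · rw [h t ht, lintegral_exp_gammaMeasure ha hb ht]
  · rw [h t ht]
    exact ENNReal.ofReal_ne_top

lemma lintegral_pi_prod {ι : Type*} [Fintype ι] {S : ι → Type*} [∀ i, MeasurableSpace (S i)]
    (μ : ∀ i, Measure (S i)) [∀ i, IsProbabilityMeasure (μ i)] {f : ∀ i, S i → ℝ≥0∞}
    (hf : ∀ i, Measurable (f i)) :
    ∫⁻ s, ∏ i, f i (s i) ∂Measure.pi μ = ∏ i, ∫⁻ x, f i x ∂μ i := by
  refine (lintegral_prod_eq_prod_lintegral_of_indepFun Finset.univ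
    (fun i (s : ∀ i, S i) => f i (s i)) (iIndepFun_pi fun i => (hf i).aemeasurable)
    (fun i => (hf i).comp (measurable_pi_apply i))).trans ?_
  exact Finset.prod_congr rfl fun i _ =>
    (measurePreserving_eval μ i).lintegral_comp (hf i)

/-- A sum of independent variables with a common Gamma law has a Gamma law. -/
lemma map_sum_pi_eq_gammaMeasure {ι S : Type*} [Fintype ι] [Nonempty ι] [MeasurableSpace S]
    {ν : Measure S} [IsProbabilityMeasure ν] {g : S → ℝ} (hg : Measurable g) {a b : ℝ}
    (ha : 0 < a) (hb : 0 < b) (hν : ν.map g = gammaMeasure a b) :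
    (Measure.pi fun _ : ι => ν).map (fun s => ∑ i, g (s i)) =
      gammaMeasure (Fintype.card ι * a) b := by
  have hι : (0 : ℝ) < Fintype.card ι := by exact_mod_cast Fintype.card_pos
  have hm : Measurable fun s : ι → S => ∑ i, g (s i) := by fun_prop
  have := Measure.isProbabilityMeasure_map (μ := Measure.pi fun _ : ι => ν) hm.aemeasurable
  refine eq_gammaMeasure_of_lintegral_exp (by positivity) hb fun t ht => ?_
  rw [lintegral_map (by fun_prop) hm]
  have h (s : ι → S) : ENNReal.ofReal (Real.exp (t * ∑ i, g (s i))) =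
      ∏ i, ENNReal.ofReal (Real.exp (t * g (s i))) := by
    rw [← ENNReal.ofReal_prod_of_nonneg fun i _ => (Real.exp_pos _).le, ← Real.exp_sum,
      Finset.mul_sum]
  simp_rw [h]
  rw [lintegral_pi_prod (fun _ => ν) (f := fun _ x => ENNReal.ofReal (Real.exp (t * g x)))
    (by fun_prop), Finset.prod_const, ← lintegral_map (f := fun x => ENNReal.ofReal
      (Real.exp (t * x))) (by fun_prop) hg, hν, lintegral_exp_gammaMeasure ha hb ht,
    Finset.card_univ, ← ENNReal.ofReal_pow (by have := sub_pos.2 ht; positivity),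
    ← Real.rpow_natCast, ← Real.rpow_mul (by have := sub_pos.2 ht; positivity), mul_comm a]

/-- A positive multiple of a Gamma variable has a Gamma law. -/
lemma map_const_mul_gammaMeasure {a b c : ℝ} (ha : 0 < a) (hb : 0 < b) (hc : 0 < c) :
    (gammaMeasure a b).map (fun x => c * x) = gammaMeasure a (b / c) := by
  have := isProbabilityMeasure_gammaMeasure ha hb
  have hm : Measurable fun x : ℝ => c * x := by fun_prop
  have := Measure.isProbabilityMeasure_map (μ := gammaMeasure a b) hm.aemeasurable
  refine eq_gammaMeasure_of_lintegral_exp ha (div_pos hb hc) fun t ht => ?_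
  rw [lintegral_map (by fun_prop) hm]
  simp_rw [← mul_assoc]
  have ht' : t * c < b := (lt_div_iff₀ hc).1 ht
  rw [lintegral_exp_gammaMeasure ha hb ht']
  congr 2
  have : b / c - t = (b - t * c) / c := by field_simp
  rw [this, div_div_div_cancel_right₀ hc.ne']

/-- An upper bound of Stirling type for the Gamma function. -/
lemma Real.Gamma_add_one_le {s : ℝ} (hs : 0 < s) :
    Real.Gamma (s + 1) ≤ Real.exp 1 * (s + 1) * (s ^ s * Real.exp (-s)) := by
  have hs1 : 0 < s + 1 := by linarith
  set M : ℝ := Real.exp 1 * (s ^ s * Real.exp (-s)) with hM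
  -- The tangent to `log` is taken at `s + 1`: at the maximizer `s` of the integrand it would cancel
  -- all of `exp (-x)`, whereas here the integrable factor `exp (-x / (s + 1))` is left. The second
  -- logarithm bound turns `(s + 1) ^ s` into `s ^ s` at the cost of a factor `e`.
  have hbound : ∀ x ∈ Set.Ioi (0 : ℝ),
      Real.exp (-x) * x ^ (s + 1 - 1) ≤ M * Real.exp (-(1 / (s + 1)) * x) := by
    intro x hx
    have hx : 0 < x := hx
    have h1 : Real.log (x / (s + 1)) ≤ x / (s + 1) - 1 := Real.log_le_sub_one_of_pos (by positivity)
    have h2 : Real.log ((s + 1) / s) ≤ (s + 1) / s - 1 := Real.log_le_sub_one_of_pos (by positivity)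
    rw [Real.log_div hx.ne' hs1.ne'] at h1
    rw [Real.log_div hs1.ne' hs.ne'] at h2
    have h1' := mul_le_mul_of_nonneg_left h1 hs.le
    have h2' := mul_le_mul_of_nonneg_left h2 hs.le
    have e2 : s * ((s + 1) / s - 1) = 1 := by field_simp; ring
    have e1 : s * (x / (s + 1) - 1) = x - 1 / (s + 1) * x - s := by field_simp; ring
    rw [hM, add_sub_cancel_right, Real.rpow_def_of_pos hx, Real.rpow_def_of_pos hs,
      ← Real.exp_add, ← Real.exp_add, ← Real.exp_add, ← Real.exp_add, Real.exp_le_exp]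
    linarith
  have hexp := integral_exp_mul_Ioi (a := -(1 / (s + 1))) (by simpa using hs1) 0
  have hint : IntegrableOn (fun x => Real.exp (-(1 / (s + 1)) * x)) (Set.Ioi 0) :=
    integrableOn_exp_mul_Ioi (by simpa using hs1) 0
  calc Real.Gamma (s + 1) = ∫ x in Set.Ioi 0, Real.exp (-x) * x ^ (s + 1 - 1) :=
        Real.Gamma_eq_integral hs1
    _ ≤ ∫ x in Set.Ioi 0, M * Real.exp (-(1 / (s + 1)) * x) :=
        setIntegral_mono_on (Real.GammaIntegral_convergent hs1) (hint.const_mul M)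
          measurableSet_Ioi hbound
    _ = Real.exp 1 * (s + 1) * (s ^ s * Real.exp (-s)) := by
        rw [integral_const_mul, hexp, hM]
        simp
        ring

/-- A lower bound for the distribution function of a Gamma variable. -/
lemma le_gammaMeasure_Iic {s b y : ℝ} (hs : 0 < s) (hb : 0 < b) (hy : 0 < y) :
    ENNReal.ofReal ((b * y) ^ s * Real.exp (-(b * y)) / Real.Gamma (s + 1)) ≤
      gammaMeasure s b (Set.Iic y) := by
  have hΓ : 0 < Real.Gamma s := Real.Gamma_pos_of_pos hs
  have hint : ∫⁻ x in Set.Ioc 0 y, ENNReal.ofReal (x ^ (s - 1)) = ENNReal.ofReal (y ^ s / s) := by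
    have hi : IntervalIntegrable (fun x : ℝ => x ^ (s - 1)) volume 0 y :=
      intervalIntegral.intervalIntegrable_rpow' (by linarith)
    rw [← ofReal_integral_eq_lintegral_ofReal
      ((intervalIntegrable_iff_integrableOn_Ioc_of_le hy.le).1 hi)
      ((ae_restrict_iff' measurableSet_Ioc).2 (ae_of_all _ fun x hx =>
        Real.rpow_nonneg hx.1.le _)),
      ← intervalIntegral.integral_of_le hy.le, integral_rpow (Or.inl (by linarith))]
    simp [hs.ne']
  rw [gammaMeasure, withDensity_apply _ measurableSet_Iic]
  -- On `(0, y]` the exponential factor is at least its value at `y`, and the remaining power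
  -- integrates explicitly.
  calc ENNReal.ofReal ((b * y) ^ s * Real.exp (-(b * y)) / Real.Gamma (s + 1))
      = ENNReal.ofReal (b ^ s / Real.Gamma s * Real.exp (-(b * y))) *
          ENNReal.ofReal (y ^ s / s) := by
        rw [← ENNReal.ofReal_mul (by positivity), Real.Gamma_add_one hs.ne',
          Real.mul_rpow hb.le hy.le]
        congr 1
        field_simp
    _ = ∫⁻ x in Set.Ioc 0 y, ENNReal.ofReal (b ^ s / Real.Gamma s * Real.exp (-(b * y))) *
          ENNReal.ofReal (x ^ (s - 1)) := by
        rw [lintegral_const_mul' _ _ ENNReal.ofReal_ne_top, hint]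
    _ ≤ ∫⁻ x in Set.Ioc 0 y, gammaPDF s b x := by
        refine setLIntegral_mono' measurableSet_Ioc fun x hx => ?_
        have hx0 : 0 < x := hx.1
        rw [gammaPDF_of_nonneg hx0.le, ← ENNReal.ofReal_mul (by positivity)]
        refine ENNReal.ofReal_le_ofReal ?_
        have : Real.exp (-(b * y)) ≤ Real.exp (-(b * x)) :=
          Real.exp_le_exp.2 (neg_le_neg (mul_le_mul_of_nonneg_left hx.2 hb.le))
        calc b ^ s / Real.Gamma s * Real.exp (-(b * y)) * x ^ (s - 1)
            = b ^ s / Real.Gamma s * x ^ (s - 1) * Real.exp (-(b * y)) := by ring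
          _ ≤ _ := by gcongr
    _ ≤ ∫⁻ x in Set.Iic y, gammaPDF s b x :=
        lintegral_mono_set Set.Ioc_subset_Iic_self

end Gamma

/-! ### Outage exponents of rates that are asymptotically linear in the power -/

section Outage

variable {S : Type*} [MeasurableSpace S]

/-- The rate `J γ s` lies between `γ g(s) - O((γ g(s))²)` and `γ g(s)` at low power. -/
structure IsLowPowerRate (J : ℝ≥0 → S → ℝ≥0∞) (g : S → ℝ) : Prop where
  measurable : Measurable g
  nonneg : ∀ s, 0 ≤ g s
  upper : ∀ γ : ℝ≥0, 0 < γ → ∀ s, J γ s ≤ ENNReal.ofReal (γ * g s)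
  lower : ∃ C δ : ℝ, 0 < δ ∧ ∀ γ : ℝ≥0, 0 < γ → ∀ s, γ * g s ≤ δ →
    ENNReal.ofReal (γ * g s - C * (γ * g s) ^ 2) ≤ J γ s

lemma neg_le_neg_log_div {p : ℝ≥0∞} {K : ℕ} (hK : 0 < K) {x : ℝ}
    (h : p ≤ ENNReal.ofReal (Real.exp (K * x))) : ((-x : ℝ) : EReal) ≤ -ENNReal.log p / K := by
  have hK' : (0 : ℝ) < K := by exact_mod_cast hK
  have h1 := ENNReal.log_le_log h
  rw [ENNReal.log_ofReal_of_pos (Real.exp_pos _), Real.log_exp] at h1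
  have h2 : ((-(K * x) : ℝ) : EReal) ≤ -ENNReal.log p := by
    rw [EReal.coe_neg]
    exact EReal.neg_le_neg_iff.2 h1
  calc ((-x : ℝ) : EReal) = ((-(K * x) / K : ℝ) : EReal) := by
        congr 1; field_simp
    _ = ((-(K * x) : ℝ) : EReal) / K := by rw [EReal.coe_div]; rfl
    _ ≤ _ := EReal.div_le_div_right_of_nonneg (by positivity) h2

lemma neg_log_div_le_neg {p : ℝ≥0∞} {K : ℕ} (hK : 0 < K) {x : ℝ}
    (h : ENNReal.ofReal (Real.exp (K * x)) ≤ p) : -ENNReal.log p / K ≤ ((-x : ℝ) : EReal) := by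
  have hK' : (0 : ℝ) < K := by exact_mod_cast hK
  have h1 := ENNReal.log_le_log h
  rw [ENNReal.log_ofReal_of_pos (Real.exp_pos _), Real.log_exp] at h1
  have h2 : -ENNReal.log p ≤ ((-(K * x) : ℝ) : EReal) := by
    rw [EReal.coe_neg]
    exact EReal.neg_le_neg_iff.2 h1
  calc _ ≤ ((-(K * x) : ℝ) : EReal) / K := EReal.div_le_div_right_of_nonneg (by positivity) h2
    _ = ((-(K * x) / K : ℝ) : EReal) := by rw [EReal.coe_div]; rfl
    _ = ((-x : ℝ) : EReal) := by congr 1; field_simp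

/-- The truncated quadratic minorant of the rate, as a function of `γ g(s)`. -/
noncomputable def quadMinorant (C δ t : ℝ) : ℝ := if t ≤ δ then max 0 (t - C * t ^ 2) else 0

/-- The truncation is there for this sign: it bounds the Chernoff integrands by `1`, which permits
dominated convergence. -/
lemma quadMinorant_nonneg (C δ t : ℝ) : 0 ≤ quadMinorant C δ t := by
  unfold quadMinorant
  split_ifs
  · exact le_max_left _ _
  · exact le_rfl

lemma measurable_quadMinorant (C δ : ℝ) : Measurable (quadMinorant C δ) :=
  Measurable.ite measurableSet_Iic (by fun_prop) measurable_const

/-- For fixed `x` the cutoff is eventually inactive and the quadratic correction is only `C * x ^ 2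
/ K`. -/
lemma tendsto_mul_quadMinorant (C : ℝ) {δ x : ℝ} (hδ : 0 < δ) (hx : 0 ≤ x) :
    Tendsto (fun K : ℕ => K * quadMinorant C δ (x / K)) atTop (𝓝 x) := by
  have h1 : Tendsto (fun K : ℕ => max 0 (x - C * x ^ 2 / K)) atTop (𝓝 (max 0 (x - 0))) :=
    tendsto_const_nhds.max (tendsto_const_nhds.sub (tendsto_const_div_atTop_nhds_zero_nat _))
  rw [sub_zero, max_eq_right hx] at h1
  refine h1.congr' ?_
  filter_upwards [(tendsto_const_div_atTop_nhds_zero_nat x).eventually (ge_mem_nhds hδ),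
    eventually_gt_atTop 0] with K hK hK0
  have hK0' : (0 : ℝ) < K := by exact_mod_cast hK0
  rw [quadMinorant, if_pos hK, mul_max_of_nonneg _ _ hK0'.le, mul_zero]
  congr 1
  field_simp

variable {J : ℝ≥0 → S → ℝ≥0∞} {ν : Measure S} {g : S → ℝ}

/-- `IsNakagami` does not require the state law to have mass one; the mass is inherited from its
image. -/
lemma isProbabilityMeasure_of_map_eq_gammaMeasure (hg : Measurable g) {a b : ℝ} (ha : 0 < a)
    (hb : 0 < b) (hν : ν.map g = gammaMeasure a b) : IsProbabilityMeasure ν := by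
  have := isProbabilityMeasure_gammaMeasure ha hb
  refine ⟨?_⟩
  rw [← Set.preimage_univ (f := g), ← Measure.map_apply hg .univ, hν, measure_univ]

/-- The Chernoff bound for the outage probability. -/
lemma outageProb_le_chernoff [IsProbabilityMeasure ν] (hg : Measurable g) {C δ : ℝ}
    (hJ : ∀ γ : ℝ≥0, 0 < γ → ∀ s, γ * g s ≤ δ →
      ENNReal.ofReal (γ * g s - C * (γ * g s) ^ 2) ≤ J γ s)
    {K : ℕ} (hK : 0 < K) {ρ : ℝ≥0} (hρ : 0 < ρ) (r : ℝ≥0) {l : ℝ} (hl : 0 ≤ l) :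
    outageProb J ν K ρ r ≤ ENNReal.ofReal (Real.exp (l * K * r)) *
      (∫⁻ s, ENNReal.ofReal (Real.exp (-l * (K * quadMinorant C δ (ρ * g s / K)))) ∂ν) ^ K := by
  have hK' : (0 : ℝ) < K := by exact_mod_cast hK
  have hm : Measurable fun s => quadMinorant C δ (ρ * g s / K) :=
    (measurable_quadMinorant C δ).comp (by fun_prop)
  have hmF : Measurable fun s : S =>
    ENNReal.ofReal (Real.exp (-l * (K * quadMinorant C δ (ρ * g s / K)))) := by fun_prop
  have hmin (s : S) : ENNReal.ofReal (quadMinorant C δ (ρ * g s / K)) ≤ J (ρ / K) s := by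
    have hc : (((ρ / K : ℝ≥0) : ℝ)) * g s = ρ * g s / K := by push_cast; ring
    unfold quadMinorant
    split_ifs with h
    · rw [← hc] at h ⊢
      rw [ENNReal.ofReal_max]
      simpa using hJ (ρ / K) (div_pos hρ (by exact_mod_cast hK)) s h
    · simp
  -- Individual rates are of order `1 / K`, so the tilt is `l * K`. Since `f ≥ 1` on the outage
  -- event, Markov's inequality bounds its probability by the integral of `f`.
  set f : (Fin K → S) → ℝ≥0∞ := fun s => ENNReal.ofReal (Real.exp (l * K * r)) *
    ∏ k, ENNReal.ofReal (Real.exp (-l * (K * quadMinorant C δ (ρ * g (s k) / K)))) with hf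
  have hfm : Measurable f := by
    refine Measurable.const_mul (Finset.measurable_prod _ fun k _ => ?_) _
    exact hmF.comp (measurable_pi_apply k)
  have hsub : {s : Fin K → S | ∑ k, J (ρ / K) (s k) ≤ r} ⊆ {s | 1 ≤ f s} := by
    intro s hs
    have h1 : ENNReal.ofReal (∑ k, quadMinorant C δ (ρ * g (s k) / K)) ≤ r := by
      rw [ENNReal.ofReal_sum_of_nonneg fun k _ => quadMinorant_nonneg _ _ _]
      exact (Finset.sum_le_sum fun k _ => hmin (s k)).trans hs
    have h2 : ∑ k, quadMinorant C δ (ρ * g (s k) / K) ≤ r := by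
      rw [← ENNReal.ofReal_coe_nnreal] at h1
      exact (ENNReal.ofReal_le_ofReal_iff r.2).1 h1
    simp only [Set.mem_ofPred_eq, hf]
    rw [← ENNReal.ofReal_prod_of_nonneg fun i _ => (Real.exp_pos _).le, ← Real.exp_sum,
      ← ENNReal.ofReal_mul (Real.exp_pos _).le, ← Real.exp_add, ← ENNReal.ofReal_one]
    refine ENNReal.ofReal_le_ofReal (Real.one_le_exp ?_)
    rw [← Finset.mul_sum, ← Finset.mul_sum]
    have := mul_le_mul_of_nonneg_left h2 (mul_nonneg hl hK'.le)
    linarith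
  calc outageProb J ν K ρ r ≤ Measure.pi (fun _ : Fin K => ν) {s | 1 ≤ f s} := measure_mono hsub
    _ ≤ ∫⁻ s, f s ∂Measure.pi (fun _ : Fin K => ν) := by
        simpa using mul_meas_ge_le_lintegral (μ := Measure.pi (fun _ : Fin K => ν)) hfm 1
    _ = _ := by
        rw [hf, lintegral_const_mul' _ _ ENNReal.ofReal_ne_top,
          lintegral_pi_prod (fun _ => ν) (f := fun _ s =>
            ENNReal.ofReal (Real.exp (-l * (K * quadMinorant C δ (ρ * g s / K)))))
            (fun _ => hmF), Finset.prod_const, Finset.card_univ, Fintype.card_fin]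

/-- The outage probability is at least a Gamma distribution function. -/
lemma gammaMeasure_Iic_le_outageProb [IsProbabilityMeasure ν] (hg : Measurable g)
    (hg0 : ∀ s, 0 ≤ g s)
    (hJ : ∀ γ : ℝ≥0, 0 < γ → ∀ s, J γ s ≤ ENNReal.ofReal (γ * g s))
    {a b : ℝ} (ha : 0 < a) (hb : 0 < b) (hν : ν.map g = gammaMeasure a b)
    {K : ℕ} (hK : 0 < K) {ρ : ℝ≥0} (hρ : 0 < ρ) (r : ℝ≥0) :
    gammaMeasure (K * a) b (Set.Iic (K * (r / ρ))) ≤ outageProb J ν K ρ r := by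
  have hK' : (0 : ℝ) < K := by exact_mod_cast hK
  have hρ' : (0 : ℝ) < ρ := hρ
  have : Nonempty (Fin K) := ⟨⟨0, hK⟩⟩
  have hlaw := map_sum_pi_eq_gammaMeasure (ι := Fin K) hg ha hb hν
  rw [Fintype.card_fin] at hlaw
  rw [← hlaw, Measure.map_apply (by fun_prop) measurableSet_Iic]
  refine measure_mono fun s hs => ?_
  have hs : ∑ k, g (s k) ≤ K * (r / ρ) := hs
  calc ∑ k, J (ρ / K) (s k) ≤ ∑ k, ENNReal.ofReal (((ρ / K : ℝ≥0) : ℝ) * g (s k)) :=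
        Finset.sum_le_sum fun k _ => hJ _ (div_pos hρ (by exact_mod_cast hK)) _
    _ = ENNReal.ofReal (ρ / K * ∑ k, g (s k)) := by
        rw [← ENNReal.ofReal_sum_of_nonneg fun k _ => mul_nonneg (NNReal.coe_nonneg _) (hg0 _),
          ← Finset.mul_sum]
        push_cast
        rfl
    _ ≤ ENNReal.ofReal r := by
        refine ENNReal.ofReal_le_ofReal ?_
        calc (ρ : ℝ) / K * ∑ k, g (s k) ≤ ρ / K * (K * (r / ρ)) := by gcongr
          _ = r := by field_simp
    _ = r := ENNReal.ofReal_coe_nnreal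

/-- This is the normalized logarithm of the prefactor `e * (s + 1)` in `Real.Gamma_add_one_le`, at
`s = K * a`. -/
lemma tendsto_log_linear_div {a : ℝ} (ha : 0 < a) :
    Tendsto (fun K : ℕ => (1 + Real.log (K * a + 1)) / K) atTop (𝓝 0) := by
  have h1 : Tendsto (fun K : ℕ => (K : ℝ) * a + 1) atTop atTop :=
    tendsto_atTop_add_const_right _ _ (tendsto_natCast_atTop_atTop.atTop_mul_const ha)
  have h2 : Tendsto (fun x : ℝ => Real.log x / x) atTop (𝓝 0) :=
    Real.isLittleO_log_id_atTop.tendsto_div_nhds_zero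
  have h3 : Tendsto (fun K : ℕ => (K * a + 1) / K) atTop (𝓝 (a + 0)) := by
    have h : Tendsto (fun K : ℕ => a + 1 / (K : ℝ)) atTop (𝓝 (a + 0)) :=
      tendsto_const_nhds.add (tendsto_const_div_atTop_nhds_zero_nat 1)
    refine h.congr' ?_
    filter_upwards [eventually_gt_atTop 0] with K hK
    have hK' : (0 : ℝ) < K := by exact_mod_cast hK
    field_simp
  have h4 := (tendsto_const_div_atTop_nhds_zero_nat 1).add ((h2.comp h1).mul h3)
  rw [zero_mul, add_zero] at h4
  refine h4.congr' ?_
  filter_upwards [eventually_gt_atTop 0] with K hK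
  have hK' : (0 : ℝ) < K := by exact_mod_cast hK
  have : (0 : ℝ) < K * a + 1 := by positivity
  simp only [Function.comp]
  field_simp

/-- Cramér's theorem for Gamma variables, robust to a quadratic error in the rate. The condition `b
/ a ≤ η` places `1 / η` at or below the mean, where the lower tail decides. -/
lemma IsLowPowerRate.hasOutageExponent (hJ : IsLowPowerRate J g) {a b : ℝ} (ha : 0 < a)
    (hb : 0 < b) (hν : ν.map g = gammaMeasure a b) {η : ℝ} (hη : b / a ≤ η) :
    HasOutageExponent J ν η ((a * (b / (a * η) - 1 + Real.log (a * η / b)) : ℝ) : EReal) := by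
  have := isProbabilityMeasure_of_map_eq_gammaMeasure hJ.measurable ha hb hν
  intro ρ r hρ hr hη'
  have hρ' : (0 : ℝ) < ρ := hρ
  have hr' : (0 : ℝ) < r := hr
  have hη0 : 0 < η := by rw [← hη']; positivity
  obtain ⟨C, δ, hδ, hlow⟩ := hJ.lower
  have hab : b ≤ a * η := by rwa [div_le_iff₀' ha] at hη
  -- The minimizer of `l * r + a * log (b / (b + l * ρ))`, that is, the solution of `b + l * ρ = a *
  -- η`.
  set l : ℝ := (a * η - b) / ρ with hl
  have hl0 : 0 ≤ l := div_nonneg (by linarith) hρ'.le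
  -- the upper bound on the outage probability
  set I : ℕ → ℝ≥0∞ := fun K =>
    ∫⁻ s, ENNReal.ofReal (Real.exp (-l * (K * quadMinorant C δ (ρ * g s / K)))) ∂ν with hI
  have hgm := hJ.measurable
  have hq (K : ℕ) : Measurable fun s => quadMinorant C δ (ρ * g s / K) :=
    (measurable_quadMinorant C δ).comp (by fun_prop)
  have hI_lim : Tendsto I atTop (𝓝 (ENNReal.ofReal ((b / (a * η)) ^ a))) := by
    have hlim : ∫⁻ s, ENNReal.ofReal (Real.exp (-l * (ρ * g s))) ∂ν =
        ENNReal.ofReal ((b / (a * η)) ^ a) := by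
      have h := lintegral_exp_gammaMeasure (t := -(a * η - b)) ha hb (by linarith)
      rw [← hν, lintegral_map (by fun_prop) hgm] at h
      rw [show a * η = b - -(a * η - b) by ring, ← h]
      refine lintegral_congr fun s => ?_
      rw [hl]
      congr 2
      field_simp
    rw [← hlim]
    refine tendsto_lintegral_of_dominated_convergence (fun _ => 1) (fun K => by fun_prop)
      (fun K => ae_of_all _ fun s => ?_) (by simp) (ae_of_all _ fun s => ?_)
    · rw [← ENNReal.ofReal_one]
      refine ENNReal.ofReal_le_ofReal (Real.exp_le_one_iff.2 ?_)
      have := mul_nonneg hl0 (mul_nonneg (Nat.cast_nonneg K)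
        (quadMinorant_nonneg C δ (ρ * g s / K)))
      linarith
    · refine ENNReal.tendsto_ofReal ((Real.continuous_exp.tendsto _).comp ?_)
      exact (tendsto_mul_quadMinorant C hδ (mul_nonneg hρ'.le (hJ.nonneg s))).const_mul _
  have hpos : 0 < (b / (a * η)) ^ a := Real.rpow_pos_of_pos (by positivity) _
  have hlogI : Tendsto (fun K => -(l * r + Real.log (I K).toReal)) atTop
      (𝓝 (a * (b / (a * η) - 1 + Real.log (a * η / b)))) := by
    have h1 := ((ENNReal.tendsto_toReal ENNReal.ofReal_ne_top).comp hI_lim).log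
      (by rw [ENNReal.toReal_ofReal hpos.le]; exact hpos.ne')
    have h2 := (h1.const_add (l * r)).neg
    have he : -(l * r + Real.log (ENNReal.ofReal ((b / (a * η)) ^ a)).toReal) =
        a * (b / (a * η) - 1 + Real.log (a * η / b)) := by
      have hlr : l * r = a - b / η := by
        rw [hl, ← hη']
        field_simp
      rw [ENNReal.toReal_ofReal hpos.le, Real.log_rpow (by positivity), hlr,
        ← inv_div (a * η) b, Real.log_inv]
      field_simp
      ring
    rw [he] at h2
    exact h2
  -- The limit of `I` is positive and finite, so eventually `I K` is the exponential of its real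
  -- logarithm.
  have hlower : ∀ᶠ K in atTop, ((-(l * r + Real.log (I K).toReal) : ℝ) : EReal) ≤
      -ENNReal.log (outageProb J ν K ρ r) / (K : EReal) := by
    filter_upwards [eventually_gt_atTop 0,
      hI_lim.eventually_ne (ENNReal.ofReal_pos.2 hpos).ne',
      hI_lim.eventually_ne ENNReal.ofReal_ne_top] with K hK hI0 hIt
    refine neg_le_neg_log_div hK ?_
    refine (outageProb_le_chernoff hgm hlow hK hρ r hl0).trans_eq ?_
    have hIe : I K = ENNReal.ofReal (Real.exp (Real.log (I K).toReal)) := by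
      rw [Real.exp_log (ENNReal.toReal_pos hI0 hIt), ENNReal.ofReal_toReal hIt]
    change _ * I K ^ K = _
    rw [hIe, ← ENNReal.ofReal_pow (Real.exp_pos _).le, ← Real.exp_nat_mul,
      ← ENNReal.ofReal_mul (Real.exp_pos _).le, ← Real.exp_add,
      ENNReal.toReal_ofReal (Real.exp_pos _).le, Real.log_exp]
    congr 2
    ring
  -- the lower bound on the outage probability
  have hupper : ∀ᶠ K : ℕ in atTop, -ENNReal.log (outageProb J ν K ρ r) / (K : EReal) ≤
      ((a * (b / (a * η) - 1 + Real.log (a * η / b)) + (1 + Real.log (K * a + 1)) / K : ℝ) :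
        EReal) := by
    filter_upwards [eventually_gt_atTop 0] with K hK
    have hK' : (0 : ℝ) < K := by exact_mod_cast hK
    have hs : 0 < K * a := by positivity
    have hy : 0 < (K : ℝ) * (r / ρ) := by positivity
    have hΓ := Real.Gamma_pos_of_pos (show 0 < K * a + 1 by positivity)
    rw [← neg_neg (a * (b / (a * η) - 1 + Real.log (a * η / b)) + (1 + Real.log (K * a + 1)) / K)]
    refine neg_log_div_le_neg hK (le_trans ?_ ((le_gammaMeasure_Iic hs hb hy).trans
      (gammaMeasure_Iic_le_outageProb hgm hJ.nonneg hJ.upper ha hb hν hK hρ r)))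
    refine ENNReal.ofReal_le_ofReal ?_
    rw [le_div_iff₀ hΓ]
    refine (mul_le_mul_of_nonneg_left (Real.Gamma_add_one_le hs) (Real.exp_pos _).le).trans
      (le_of_eq ?_)
    -- The point `b * K * r / ρ` is `K * a` divided by `a * η / b`, so the powers `(K * a) ^ (K *
    -- a)` of the numerator and of the Stirling bound cancel.
    have hlog : Real.log (b * (K * (r / ρ))) =
        Real.log (K * a) - Real.log (a * η / b) := by
      rw [← Real.log_div hs.ne' (by positivity), ← hη']
      congr 1
      field_simp
    have hb1 : b * (K * (r / ρ)) = K * (b / η) := by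
      rw [← hη']
      field_simp
    rw [Real.rpow_def_of_pos (mul_pos hb hy), hlog, hb1, Real.rpow_def_of_pos hs]
    nth_rewrite 2 [← Real.exp_log (show 0 < K * a + 1 by positivity)]
    simp only [← Real.exp_add]
    congr 1
    field_simp
    ring
  refine tendsto_of_tendsto_of_tendsto_of_le_of_le' (EReal.tendsto_coe.2 hlogI) ?_ hlower hupper
  refine EReal.tendsto_coe.2 ?_
  simpa using (tendsto_log_linear_div ha).const_add
    (a * (b / (a * η) - 1 + Real.log (a * η / b)))

/-- The minimum energy per nat of a rate that is asymptotically linear in the power. -/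
lemma IsLowPowerRate.hasMinEnergyPerNat (hJ : IsLowPowerRate J g) {a b : ℝ} (ha : 0 < a)
    (hb : 0 < b) (hν : ν.map g = gammaMeasure a b) :
    HasMinEnergyPerNat J ν (ENNReal.ofReal (a / b))⁻¹ := by
  refine ⟨fun s => ENNReal.ofReal (g s), fun s => ?_, ?_⟩
  · obtain ⟨C, δ, hδ, hlow⟩ := hJ.lower
    have hγ : Tendsto (fun γ : ℝ≥0 => (γ : ℝ)) (𝓝[>] 0) (𝓝 0) :=
      (NNReal.continuous_coe.tendsto' 0 0 (by simp)).mono_left nhdsWithin_le_nhds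
    have h1 : Tendsto (fun γ : ℝ≥0 => ENNReal.ofReal (g s - C * γ * g s ^ 2)) (𝓝[>] 0)
        (𝓝 (ENNReal.ofReal (g s))) := by
      refine ENNReal.tendsto_ofReal ?_
      simpa using ((hγ.const_mul C).mul_const (g s ^ 2)).const_sub (g s)
    have h2 : ∀ᶠ γ : ℝ≥0 in 𝓝[>] 0, (γ : ℝ) * g s ≤ δ := by
      have h := hγ.mul_const (g s)
      rw [zero_mul] at h
      exact h.eventually (ge_mem_nhds hδ)
    refine tendsto_of_tendsto_of_tendsto_of_le_of_le' h1 tendsto_const_nhds ?_ ?_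
    · filter_upwards [h2, self_mem_nhdsWithin] with γ hγδ hγ0
      have hγ0 : 0 < γ := hγ0
      rw [ENNReal.le_div_iff_mul_le (by simp [hγ0.ne']) (by simp), ← ENNReal.ofReal_coe_nnreal,
        ← ENNReal.ofReal_mul' (NNReal.coe_nonneg γ)]
      refine le_trans (le_of_eq ?_) (hlow γ hγ0 s hγδ)
      congr 1
      ring
    · filter_upwards [self_mem_nhdsWithin] with γ hγ0
      have hγ0 : 0 < γ := hγ0
      refine ENNReal.div_le_of_le_mul ?_
      rw [← ENNReal.ofReal_coe_nnreal (p := γ), ← ENNReal.ofReal_mul (hJ.nonneg s), mul_comm]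
      exact hJ.upper γ hγ0 s
  · rw [← lintegral_map (f := ENNReal.ofReal) ENNReal.measurable_ofReal hJ.measurable, hν,
      lintegral_ofReal_gammaMeasure ha hb]

end Outage

/-! ### Relative entropy and mutual information -/

section Information

open InformationTheory

variable {α β : Type*} [MeasurableSpace α] [MeasurableSpace β]

/-- Data processing, applied to `e` and to its inverse. -/
lemma klDiv_map_measurableEquiv (e : α ≃ᵐ β) (μ ν : Measure α) [IsFiniteMeasure μ]
    [IsFiniteMeasure ν] : klDiv (μ.map e) (ν.map e) = klDiv μ ν := by
  refine le_antisymm (klDiv_map_le _ _ e.measurable) ?_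
  have h := klDiv_map_le (μ.map e) (ν.map e) e.symm.measurable
  simpa [Measure.map_map e.symm.measurable e.measurable] using h

/-- The mutual information is at most the relative entropy with respect to any product measure
with the same input marginal. -/
lemma mutualInfo_le_klDiv [StandardBorelSpace α] [Nonempty α] (P : Measure (α × β))
    [IsProbabilityMeasure P] (Q : Measure β) [IsFiniteMeasure Q] :
    mutualInfo P ≤ klDiv P (P.fst.prod Q) := by
  have hswap (R : Measure β) [IsFiniteMeasure R] :
      klDiv P (P.fst.prod R) = klDiv (P.map Prod.swap) (R.prod P.fst) := by
    rw [← Measure.prod_swap (μ := P.fst)]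
    exact (klDiv_map_measurableEquiv MeasurableEquiv.prodComm P (P.fst.prod R)).symm
  have hfst : (P.map Prod.swap).fst = P.snd := Measure.fst_map_swap
  have hd : P.snd ⊗ₘ (P.map Prod.swap).condKernel = P.map Prod.swap := by
    rw [← hfst]
    exact Measure.disintegrate _ _
  -- With the output as first coordinate, the chain rule splits the right side into the divergence
  -- of the output law from `Q` plus the mutual information.
  rw [mutualInfo, hswap, hswap Q, ← Measure.compProd_const, ← Measure.compProd_const, ← hd,
    klDiv_compProd_eq_add P.snd Q]
  exact le_add_self

/-- The Donsker–Varadhan lower bound for the relative entropy. -/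
lemma le_klDiv_of_integral_exp_le {μ ν : Measure α} [IsProbabilityMeasure μ]
    [IsProbabilityMeasure ν] {f : α → ℝ} (hf : Integrable f μ)
    (hexp : Integrable (fun x => Real.exp (f x)) ν) {C : ℝ}
    (hC : ∫ x, Real.exp (f x) ∂ν ≤ C) :
    ENNReal.ofReal (∫ x, f x ∂μ - Real.log C) ≤ klDiv μ ν := by
  by_cases h : klDiv μ ν = ∞
  · simp [h]
  obtain ⟨hac, hint⟩ := klDiv_ne_top_iff.1 h
  have := isProbabilityMeasure_tilted hexp
  have hac' : μ ≪ ν.tilted f := hac.trans (absolutelyContinuous_tilted hexp)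
  -- Gibbs' inequality against the tilted measure `ν.tilted f` is the claim after expanding the
  -- log-likelihood ratio.
  have h1 := integral_llr_add_sub_measure_univ_nonneg hac'
    (integrable_llr_tilted_right hac hf hint hexp)
  rw [integral_llr_tilted_right hac hf hexp hint] at h1
  have h2 : Real.log (∫ x, Real.exp (f x) ∂ν) ≤ Real.log C :=
    Real.log_le_log (integral_exp_pos hexp) hC
  rw [klDiv_of_ac_of_integrable hac hint]
  refine ENNReal.ofReal_le_ofReal ?_
  simp at h1 ⊢
  linarith

/-- The relative entropy of an exponentially tilted measure. -/
lemma klDiv_withDensity_exp {μ : Measure α} [IsProbabilityMeasure μ] {f : α → ℝ}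
    (hfm : Measurable f)
    [hP : IsProbabilityMeasure (μ.withDensity fun x => ENNReal.ofReal (Real.exp (f x)))]
    (hf : Integrable f (μ.withDensity fun x => ENNReal.ofReal (Real.exp (f x)))) :
    klDiv (μ.withDensity fun x => ENNReal.ofReal (Real.exp (f x))) μ =
      ENNReal.ofReal (∫ x, f x ∂(μ.withDensity fun x => ENNReal.ofReal (Real.exp (f x)))) := by
  set P := μ.withDensity fun x => ENNReal.ofReal (Real.exp (f x)) with hPdef
  have hac : P ≪ μ := withDensity_absolutelyContinuous _ _
  have hllr : llr P μ =ᵐ[P] f := by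
    refine hac.ae_le ?_
    filter_upwards [Measure.rnDeriv_withDensity μ
      (f := fun x => ENNReal.ofReal (Real.exp (f x))) (by fun_prop)] with x hx
    rw [llr, hPdef, hx, ENNReal.toReal_ofReal (Real.exp_pos _).le, Real.log_exp]
  rw [klDiv_of_ac_of_integrable hac (hf.congr hllr.symm), integral_congr_ae hllr]
  simp

end Information

/-! ### Gaussian laws -/

section Gaussian

lemma lintegral_gaussianReal {w : ℝ≥0} (hw : w ≠ 0) (c : ℝ) {f : ℝ → ℝ≥0∞} (hf : Measurable f) :
    ∫⁻ x, f x ∂gaussianReal c w = ∫⁻ x, gaussianPDF c w x * f x := by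
  rw [gaussianReal_of_var_ne_zero _ hw,
    lintegral_withDensity_eq_lintegral_mul _ (measurable_gaussianPDF c w) hf]
  rfl

/-- The tilted density is a multiple of the centred Gaussian density of variance `w / (1 - 2 * t *
w)`. -/
lemma lintegral_exp_mul_sq_gaussianReal {w : ℝ≥0} (hw : w ≠ 0) {t : ℝ} (ht : 2 * t * w < 1) :
    ∫⁻ x, ENNReal.ofReal (Real.exp (t * x ^ 2)) ∂gaussianReal 0 w =
      ENNReal.ofReal (√(1 / (1 - 2 * t * w))) := by
  have hd : 0 < 1 - 2 * t * w := by linarith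
  have hw0 : (0 : ℝ) < w := lt_of_le_of_ne w.2 (by exact_mod_cast hw.symm)
  set w' : ℝ≥0 := ⟨w / (1 - 2 * t * w), by positivity⟩ with hw'
  have hwc : (w' : ℝ) = w / (1 - 2 * t * w) := rfl
  have hw'0 : w' ≠ 0 := by
    intro h
    have : (w' : ℝ) = 0 := by rw [h]; rfl
    rw [hwc] at this
    exact (div_pos hw0 hd).ne' this
  rw [lintegral_gaussianReal hw 0 (by fun_prop)]
  have h (x : ℝ) : gaussianPDF 0 w x * ENNReal.ofReal (Real.exp (t * x ^ 2)) =
      ENNReal.ofReal (√(1 / (1 - 2 * t * w))) * gaussianPDF 0 w' x := by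
    rw [gaussianPDF, gaussianPDF, ← ENNReal.ofReal_mul (gaussianPDFReal_nonneg _ _ _),
      ← ENNReal.ofReal_mul (by positivity)]
    congr 1
    have h1 : √(2 * Real.pi * w') = √(2 * Real.pi * w) / √(1 - 2 * t * w) := by
      rw [← Real.sqrt_div' _ hd.le, hwc, mul_div_assoc]
    have h2 : -(x - 0) ^ 2 / (2 * w') = -(x - 0) ^ 2 / (2 * w) + t * x ^ 2 := by
      rw [hwc]
      field_simp
      ring
    have h3 : √(1 - 2 * t * w) ≠ 0 := (Real.sqrt_pos.2 hd).ne'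
    rw [gaussianPDFReal, gaussianPDFReal, h1, h2, Real.exp_add, Real.sqrt_div' _ hd.le,
      Real.sqrt_one]
    generalize √(1 - 2 * t * w) = D at h3
    field_simp
  simp_rw [h]
  rw [lintegral_const_mul' _ _ ENNReal.ofReal_ne_top, lintegral_gaussianPDF_eq_one 0 hw'0, mul_one]

/-- The density of a shifted Gaussian law with respect to the unshifted one. -/
lemma lintegral_const_add_gaussianReal {w : ℝ≥0} (hw : w ≠ 0) (c : ℝ) {f : ℝ → ℝ≥0∞}
    (hf : Measurable f) :
    ∫⁻ x, f (c + x) ∂gaussianReal 0 w =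
      ∫⁻ x, ENNReal.ofReal (Real.exp ((2 * c * x - c ^ 2) / (2 * w))) * f x ∂gaussianReal 0 w := by
  have hw0 : (0 : ℝ) < w := lt_of_le_of_ne w.2 (by exact_mod_cast hw.symm)
  rw [← lintegral_map (f := f) (g := fun x => c + x) hf (by fun_prop), gaussianReal_map_const_add,
    lintegral_gaussianReal hw _ hf, lintegral_gaussianReal hw _ (by fun_prop)]
  refine lintegral_congr fun x => ?_
  rw [← mul_assoc]
  congr 1
  rw [gaussianPDF, gaussianPDF, ← ENNReal.ofReal_mul (gaussianPDFReal_nonneg _ _ _)]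
  congr 1
  rw [gaussianPDFReal, gaussianPDFReal, mul_assoc _ (Real.exp _), ← Real.exp_add]
  congr 2
  field_simp
  ring

instance (v : ℝ≥0) : IsProbabilityMeasure (circularGaussian v) :=
  Measure.isProbabilityMeasure_map (MeasurableEquiv.measurable _).aemeasurable

instance (n : ℕ) (v : ℝ≥0) : IsProbabilityMeasure (circularGaussianVec n v) := by
  unfold circularGaussianVec
  infer_instance

lemma lintegral_circularGaussian (v : ℝ≥0) {f : ℂ → ℝ≥0∞} (hf : Measurable f) :
    ∫⁻ z, f z ∂circularGaussian v =
      ∫⁻ x, ∫⁻ y, f ⟨x, y⟩ ∂gaussianReal 0 (v / 2) ∂gaussianReal 0 (v / 2) := by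
  rw [circularGaussian, lintegral_map hf (MeasurableEquiv.measurable _)]
  exact lintegral_prod (fun p => f (Complex.measurableEquivRealProd.symm p))
    (hf.comp (MeasurableEquiv.measurable _)).aemeasurable

lemma measurable_complex_mk : Measurable fun p : ℝ × ℝ => (⟨p.1, p.2⟩ : ℂ) :=
  Complex.measurableEquivRealProd.symm.measurable

lemma lintegral_exp_mul_normSq_circularGaussian {v : ℝ≥0} (hv : v ≠ 0) {t : ℝ} (ht : t * v < 1) :
    ∫⁻ z, ENNReal.ofReal (Real.exp (t * ‖z‖ ^ 2)) ∂circularGaussian v =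
      ENNReal.ofReal (1 / (1 - t * v)) := by
  have hv2 : v / 2 ≠ 0 := div_ne_zero hv two_ne_zero
  have ht2 : 2 * t * (v / 2 : ℝ≥0) < 1 := by
    push_cast
    linarith
  have he : 2 * t * (v / 2 : ℝ≥0) = t * v := by push_cast; ring
  rw [lintegral_circularGaussian v (by fun_prop)]
  have h (x y : ℝ) : ENNReal.ofReal (Real.exp (t * ‖(⟨x, y⟩ : ℂ)‖ ^ 2)) =
      ENNReal.ofReal (Real.exp (t * x ^ 2)) * ENNReal.ofReal (Real.exp (t * y ^ 2)) := by
    rw [← ENNReal.ofReal_mul (Real.exp_pos _).le, ← Real.exp_add, Complex.sq_norm,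
      Complex.normSq_mk]
    ring_nf
  simp_rw [h]
  simp_rw [lintegral_const_mul' _ _ ENNReal.ofReal_ne_top]
  rw [lintegral_exp_mul_sq_gaussianReal hv2 ht2, lintegral_mul_const' _ _ ENNReal.ofReal_ne_top,
    lintegral_exp_mul_sq_gaussianReal hv2 ht2, ← ENNReal.ofReal_mul (by positivity), he,
    Real.mul_self_sqrt (by have := sub_pos.2 ht; positivity)]

/-- The squared modulus of a circular-symmetric Gaussian variable is exponentially distributed. -/
lemma map_normSq_circularGaussian {v : ℝ≥0} (hv : v ≠ 0) :
    (circularGaussian v).map (fun z => ‖z‖ ^ 2) = gammaMeasure 1 (1 / v) := by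
  have hv0 : (0 : ℝ) < v := lt_of_le_of_ne v.2 (by exact_mod_cast hv.symm)
  have hm : Measurable fun z : ℂ => ‖z‖ ^ 2 := by fun_prop
  have := Measure.isProbabilityMeasure_map (μ := circularGaussian v) hm.aemeasurable
  refine eq_gammaMeasure_of_lintegral_exp one_pos (by positivity) fun t ht => ?_
  rw [lintegral_map (by fun_prop) hm,
    lintegral_exp_mul_normSq_circularGaussian hv ((lt_div_iff₀ hv0).1 ht), Real.rpow_one]
  congr 1
  have : 1 / (v : ℝ) - t = (1 - t * v) / v := by field_simp
  rw [this, div_div_div_cancel_right₀ hv0.ne']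

/-- The law of a real linear functional of a Gaussian vector. -/
lemma map_linear_circularGaussianVec (n : ℕ) (v : ℝ≥0) (c : Fin n → ℂ) :
    (circularGaussianVec n v).map
        (fun x => ∑ j, ((c j).re * (x j).re + (c j).im * (x j).im)) =
      gaussianReal 0 (v / 2 * ∑ j, ‖c j‖₊ ^ 2) := by
  have hm : Measurable fun x : Fin n → ℂ =>
      ∑ j, ((c j).re * (x j).re + (c j).im * (x j).im) := by fun_prop
  have := Measure.isProbabilityMeasure_map (μ := circularGaussianVec n v) hm.aemeasurable
  refine Measure.ext_of_charFun ?_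
  ext t
  have h1 (c : ℂ) : ∫ z, Complex.exp (t * (c.re * z.re + c.im * z.im : ℝ) * Complex.I)
      ∂circularGaussian v = Complex.exp (-(v * ‖c‖ ^ 2 * t ^ 2 / 4)) := by
    rw [circularGaussian, integral_map (MeasurableEquiv.measurable _).aemeasurable (by fun_prop)]
    have h (p : ℝ × ℝ) : Complex.exp (t * (c.re * (Complex.measurableEquivRealProd.symm p).re +
        c.im * (Complex.measurableEquivRealProd.symm p).im : ℝ) * Complex.I) =
        Complex.exp ((t * c.re : ℝ) * p.1 * Complex.I) *
          Complex.exp ((t * c.im : ℝ) * p.2 * Complex.I) := by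
      rw [← Complex.exp_add]
      have h2 : (Complex.measurableEquivRealProd.symm p).re = p.1 := rfl
      have h3 : (Complex.measurableEquivRealProd.symm p).im = p.2 := rfl
      rw [h2, h3]
      push_cast
      ring_nf
    simp_rw [h]
    rw [integral_prod_mul (fun x : ℝ => Complex.exp ((t * c.re : ℝ) * x * Complex.I))
      (fun x : ℝ => Complex.exp ((t * c.im : ℝ) * x * Complex.I)), ← charFun_apply_real,
      ← charFun_apply_real, charFun_gaussianReal, charFun_gaussianReal, ← Complex.exp_add]
    congr 1
    rw [← Complex.ofReal_pow ‖c‖, Complex.sq_norm, Complex.normSq_apply]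
    push_cast
    ring
  rw [charFun_apply_real, integral_map hm.aemeasurable (by fun_prop), charFun_gaussianReal]
  have h2 (x : Fin n → ℂ) :
      Complex.exp (t * (∑ j, ((c j).re * (x j).re + (c j).im * (x j).im) : ℝ) * Complex.I) =
        ∏ j, Complex.exp (t * ((c j).re * (x j).re + (c j).im * (x j).im : ℝ) * Complex.I) := by
    rw [← Complex.exp_sum]
    push_cast
    rw [Finset.mul_sum, Finset.sum_mul]
  simp_rw [h2]
  rw [circularGaussianVec, integral_fintype_prod_eq_prod (fun j (z : ℂ) =>
    Complex.exp (t * ((c j).re * z.re + (c j).im * z.im : ℝ) * Complex.I))]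
  simp_rw [h1]
  rw [← Complex.exp_sum]
  congr 1
  push_cast
  rw [Finset.sum_neg_distrib, ← Finset.sum_div, ← Finset.sum_mul, ← Finset.mul_sum]
  ring

lemma pi_withDensity {ι : Type*} [Fintype ι] {S : ι → Type*} [∀ i, MeasurableSpace (S i)]
    (μ : ∀ i, Measure (S i)) [∀ i, IsProbabilityMeasure (μ i)] {f : ∀ i, S i → ℝ≥0∞}
    (hf : ∀ i, Measurable (f i)) [∀ i, SigmaFinite ((μ i).withDensity (f i))] :
    Measure.pi (fun i => (μ i).withDensity (f i)) =
      (Measure.pi μ).withDensity fun x => ∏ i, f i (x i) := by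
  refine Measure.pi_eq fun s hs => ?_
  rw [withDensity_apply _ (.univ_pi hs), ← lintegral_indicator (.univ_pi hs)]
  have h (x : ∀ i, S i) : (Set.univ.pi s).indicator (fun x => ∏ i, f i (x i)) x =
      ∏ i, (s i).indicator (f i) (x i) := by
    classical
    by_cases hx : x ∈ Set.univ.pi s
    · rw [Set.indicator_of_mem hx]
      exact Finset.prod_congr rfl fun i _ => (Set.indicator_of_mem (hx i (Set.mem_univ i)) _).symm
    · rw [Set.indicator_of_notMem hx]
      obtain ⟨i, hi⟩ : ∃ i, x i ∉ s i := by simpa [Set.mem_pi] using hx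
      exact (Finset.prod_eq_zero (Finset.mem_univ i) (Set.indicator_of_notMem hi _)).symm
  simp_rw [h]
  rw [lintegral_pi_prod μ fun i => (hf i).indicator (hs i)]
  exact Finset.prod_congr rfl fun i _ => by
    rw [lintegral_indicator (hs i), withDensity_apply _ (hs i)]

/-- Cameron–Martin formula in the two real coordinates; their variance `1 / 2` gives the factor `2`
and the full `‖c‖ ^ 2`. -/
lemma map_const_add_circularGaussian (c : ℂ) :
    (circularGaussian 1).map (fun z => c + z) = (circularGaussian 1).withDensity fun z =>
      ENNReal.ofReal (Real.exp (2 * (c.re * z.re + c.im * z.im) - ‖c‖ ^ 2)) := by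
  have h2 : (1 / 2 : ℝ≥0) ≠ 0 := by simp
  refine Measure.ext_of_lintegral _ fun f hf => ?_
  have hmk := measurable_complex_mk
  rw [lintegral_map hf (by fun_prop), lintegral_withDensity_eq_lintegral_mul _ (by fun_prop) hf,
    lintegral_circularGaussian _ (by fun_prop), lintegral_circularGaussian _ (by fun_prop)]
  have hfy (x : ℝ) : Measurable fun y : ℝ => f ⟨x, y⟩ := by fun_prop
  have hadd (x y : ℝ) : c + ⟨x, y⟩ = (⟨c.re + x, c.im + y⟩ : ℂ) := rfl
  simp_rw [hadd, lintegral_const_add_gaussianReal h2 c.im (hfy _)]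
  rw [lintegral_const_add_gaussianReal h2 c.re (f := fun x => ∫⁻ y, ENNReal.ofReal
    (Real.exp ((2 * c.im * y - c.im ^ 2) / (2 * (1 / 2 : ℝ≥0)))) * f ⟨x, y⟩
      ∂gaussianReal 0 (1 / 2))]
  · refine lintegral_congr fun x => ?_
    rw [← lintegral_const_mul' _ _ ENNReal.ofReal_ne_top]
    refine lintegral_congr fun y => ?_
    rw [← mul_assoc, ← ENNReal.ofReal_mul (Real.exp_pos _).le, ← Real.exp_add, Pi.mul_apply,
      Complex.sq_norm, Complex.normSq_apply]
    congr 3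
    push_cast
    ring
  · refine Measurable.lintegral_prod_right' (f := fun p : ℝ × ℝ => ENNReal.ofReal
      (Real.exp ((2 * c.im * p.2 - c.im ^ 2) / (2 * (1 / 2 : ℝ≥0)))) * f ⟨p.1, p.2⟩) ?_
    fun_prop

/-- The log-density of the Gaussian noise shifted by `w` with respect to the unshifted noise. -/
noncomputable def shiftLogDensity {n : ℕ} (w y : Fin n → ℂ) : ℝ :=
  ∑ i, (2 * ((w i).re * (y i).re + (w i).im * (y i).im) - ‖w i‖ ^ 2)

lemma map_const_add_circularGaussianVec {n : ℕ} (w : Fin n → ℂ) :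
    (circularGaussianVec n 1).map (fun z => w + z) = (circularGaussianVec n 1).withDensity
      fun y => ENNReal.ofReal (Real.exp (shiftLogDensity w y)) := by
  have hp (i : Fin n) : IsProbabilityMeasure ((circularGaussian 1).withDensity fun z =>
      ENNReal.ofReal (Real.exp (2 * ((w i).re * z.re + (w i).im * z.im) - ‖w i‖ ^ 2))) := by
    rw [← map_const_add_circularGaussian]
    exact Measure.isProbabilityMeasure_map (by fun_prop)
  have h := Measure.pi_map_pi (μ := fun _ : Fin n => circularGaussian 1)
    (f := fun i z => w i + z) (fun i => by fun_prop)
  have h' : (circularGaussianVec n 1).map (fun z => w + z) =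
    Measure.pi fun i => (circularGaussian 1).map fun z => w i + z := h
  rw [h']
  simp_rw [map_const_add_circularGaussian]
  rw [pi_withDensity (fun _ => circularGaussian 1) (fun i => by fun_prop)]
  congr 1
  ext y
  rw [← ENNReal.ofReal_prod_of_nonneg fun i _ => (Real.exp_pos _).le, ← Real.exp_sum]
  rfl

end Gaussian

/-! ### Gaussian channels -/

section Channel

open InformationTheory

lemma measurable_shiftLogDensity {n : ℕ} :
    Measurable fun q : (Fin n → ℂ) × (Fin n → ℂ) => shiftLogDensity q.1 q.2 := by
  unfold shiftLogDensity
  fun_prop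

variable {α : Type*} [MeasurableSpace α] {n : ℕ} {φ : α → Fin n → ℂ}

lemma measurable_shiftLogDensity_comp (hφ : Measurable φ) :
    Measurable fun p : α × (Fin n → ℂ) => shiftLogDensity (φ p.1) p.2 :=
  measurable_shiftLogDensity.comp ((hφ.comp measurable_fst).prodMk measurable_snd)

lemma measurable_input_output (hφ : Measurable φ) :
    Measurable fun p : α × (Fin n → ℂ) => (p.1, φ p.1 + p.2) :=
  measurable_fst.prodMk ((hφ.comp measurable_fst).add measurable_snd)

lemma isProbabilityMeasure_inputOutputLaw (μX : Measure α) [IsProbabilityMeasure μX]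
    (hφ : Measurable φ) :
    IsProbabilityMeasure (inputOutputLaw μX (circularGaussianVec n 1) φ) :=
  Measure.isProbabilityMeasure_map (measurable_input_output hφ).aemeasurable

lemma fst_inputOutputLaw (μX : Measure α) [IsProbabilityMeasure μX] (hφ : Measurable φ) :
    (inputOutputLaw μX (circularGaussianVec n 1) φ).fst = μX := by
  rw [inputOutputLaw, Measure.fst, Measure.map_map measurable_fst (measurable_input_output hφ)]
  exact Measure.fst_prod

lemma inputOutputLaw_eq_withDensity (μX : Measure α) [IsProbabilityMeasure μX]
    (hφ : Measurable φ) :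
    inputOutputLaw μX (circularGaussianVec n 1) φ =
      (μX.prod (circularGaussianVec n 1)).withDensity fun p =>
        ENNReal.ofReal (Real.exp (shiftLogDensity (φ p.1) p.2)) := by
  have hℓ := measurable_shiftLogDensity_comp hφ
  have hio := measurable_input_output hφ
  refine Measure.ext_of_lintegral _ fun f hf => ?_
  have hfio : Measurable fun p : α × (Fin n → ℂ) => f (p.1, φ p.1 + p.2) := hf.comp hio
  have hE := hℓ.exp.ennreal_ofReal
  rw [inputOutputLaw, lintegral_map hf hio, lintegral_prod _ hfio.aemeasurable,
    lintegral_withDensity_eq_lintegral_mul _ hE hf, lintegral_prod _ (hE.mul hf).aemeasurable]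
  refine lintegral_congr fun x => ?_
  have hfx : Measurable fun y => f (x, y) := by fun_prop
  have hℓx : Measurable fun y => shiftLogDensity (φ x) y := hℓ.comp measurable_prodMk_left
  rw [← lintegral_map (f := fun y => f (x, y)) (g := fun z => φ x + z) hfx (by fun_prop),
    map_const_add_circularGaussianVec,
    lintegral_withDensity_eq_lintegral_mul _ hℓx.exp.ennreal_ofReal hfx]
  rfl

lemma lintegral_exp_shiftLogDensity (w : Fin n → ℂ) :
    ∫⁻ z, ENNReal.ofReal (Real.exp (shiftLogDensity w z)) ∂circularGaussianVec n 1 = 1 := by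
  rw [← setLIntegral_univ, ← withDensity_apply _ .univ, ← map_const_add_circularGaussianVec,
    Measure.map_apply (by fun_prop) .univ, Set.preimage_univ, measure_univ]

lemma integrable_linear_circularGaussianVec (v : ℝ≥0) (c : Fin n → ℂ) :
    Integrable (fun x : Fin n → ℂ => ∑ j, ((c j).re * (x j).re + (c j).im * (x j).im))
      (circularGaussianVec n v) := by
  have h : Integrable (fun x : ℝ => x) (gaussianReal 0 (v / 2 * ∑ j, ‖c j‖₊ ^ 2)) :=
    (memLp_id_gaussianReal 1).integrable (by simp)
  rw [← map_linear_circularGaussianVec n v c] at h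
  exact h.comp_measurable (by fun_prop)

lemma integral_linear_circularGaussianVec (v : ℝ≥0) (c : Fin n → ℂ) :
    ∫ x : Fin n → ℂ, ∑ j, ((c j).re * (x j).re + (c j).im * (x j).im)
      ∂circularGaussianVec n v = 0 := by
  have h : ∫ x : ℝ, x ∂gaussianReal 0 (v / 2 * ∑ j, ‖c j‖₊ ^ 2) = 0 := integral_id_gaussianReal
  rwa [← map_linear_circularGaussianVec n v c, integral_map (by fun_prop) (by fun_prop)] at h

lemma integrable_linear_sq_circularGaussianVec (v : ℝ≥0) (c : Fin n → ℂ) :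
    Integrable (fun x : Fin n → ℂ => (∑ j, ((c j).re * (x j).re + (c j).im * (x j).im)) ^ 2)
      (circularGaussianVec n v) := by
  have h : Integrable (fun x : ℝ => x ^ 2) (gaussianReal 0 (v / 2 * ∑ j, ‖c j‖₊ ^ 2)) :=
    (memLp_id_gaussianReal 2).integrable_sq
  rw [← map_linear_circularGaussianVec n v c] at h
  exact (integrable_map_measure (by fun_prop) (by fun_prop)).1 h

lemma integral_linear_sq_circularGaussianVec (v : ℝ≥0) (c : Fin n → ℂ) :
    ∫ x : Fin n → ℂ, (∑ j, ((c j).re * (x j).re + (c j).im * (x j).im)) ^ 2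
      ∂circularGaussianVec n v = v / 2 * ∑ j, ‖c j‖ ^ 2 := by
  have h : ∫ x : ℝ, x ^ 2 ∂gaussianReal 0 (v / 2 * ∑ j, ‖c j‖₊ ^ 2) =
      v / 2 * ∑ j, ‖c j‖ ^ 2 := by
    have h1 := variance_of_integral_eq_zero (μ := gaussianReal 0 (v / 2 * ∑ j, ‖c j‖₊ ^ 2))
      (X := fun x : ℝ => x) (by fun_prop) integral_id_gaussianReal
    rw [variance_fun_id_gaussianReal] at h1
    rw [← h1]
    push_cast
    rfl
  rwa [← map_linear_circularGaussianVec n v c, integral_map (by fun_prop) (by fun_prop)] at h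

lemma lintegral_exp_linear_circularGaussianVec (v : ℝ≥0) (c : Fin n → ℂ) :
    ∫⁻ x : Fin n → ℂ, ENNReal.ofReal
        (Real.exp (∑ j, ((c j).re * (x j).re + (c j).im * (x j).im))) ∂circularGaussianVec n v =
      ENNReal.ofReal (Real.exp (v / 4 * ∑ j, ‖c j‖ ^ 2)) := by
  have h := congrFun (mgf_id_gaussianReal (μ := 0) (v := v / 2 * ∑ j, ‖c j‖₊ ^ 2)) 1
  have hi := integrable_exp_mul_gaussianReal (μ := 0) (v := v / 2 * ∑ j, ‖c j‖₊ ^ 2) 1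
  simp only [mgf, id_eq, one_mul] at h hi
  have h2 := ofReal_integral_eq_lintegral_ofReal hi (ae_of_all _ fun x => (Real.exp_pos x).le)
  rw [h, ← map_linear_circularGaussianVec n v c, lintegral_map (by fun_prop) (by fun_prop)] at h2
  rw [← h2]
  congr 2
  push_cast
  ring

lemma integrable_of_integrable_sq {μ : Measure α} [IsFiniteMeasure μ] {f : α → ℝ}
    (hf : Measurable f) (h : Integrable (fun x => f x ^ 2) μ) : Integrable f μ :=
  ((memLp_two_iff_integrable_sq hf.aestronglyMeasurable).2 h).integrable (by norm_num)

/-- The log-density at the channel output. -/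
lemma shiftLogDensity_add (w u z : Fin n → ℂ) :
    shiftLogDensity w (u + z) =
      2 * ∑ i, ((u i).re * (w i).re + (u i).im * (w i).im) + shiftLogDensity w z := by
  unfold shiftLogDensity
  rw [Finset.mul_sum, ← Finset.sum_add_distrib]
  refine Finset.sum_congr rfl fun i _ => ?_
  simp only [Pi.add_apply, Complex.add_re, Complex.add_im]
  ring

/-- At the output `φ x + z` the log-density is the energy of `φ x` plus twice a real inner product
with `z`, whose mean vanishes because the noise is centred and independent of the input. -/
lemma integral_shiftLogDensity (μX : Measure α) [IsProbabilityMeasure μX] (hφ : Measurable φ)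
    (hL2 : ∀ i, Integrable (fun x => ‖φ x i‖ ^ 2) μX) :
    Integrable (fun p : α × (Fin n → ℂ) => shiftLogDensity (φ p.1) p.2)
        (inputOutputLaw μX (circularGaussianVec n 1) φ) ∧
      ∫ p, shiftLogDensity (φ p.1) p.2 ∂inputOutputLaw μX (circularGaussianVec n 1) φ =
        ∑ i, ∫ x, ‖φ x i‖ ^ 2 ∂μX := by
  have hℓ := measurable_shiftLogDensity_comp hφ
  have hio := measurable_input_output hφ
  have hφi (i : Fin n) : Measurable fun x => φ x i := by fun_prop
  have hre (i : Fin n) : Integrable (fun x => (φ x i).re) μX := by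
    refine integrable_of_integrable_sq (by fun_prop) ((hL2 i).mono' (by fun_prop) ?_)
    refine ae_of_all _ fun x => ?_
    rw [Real.norm_of_nonneg (sq_nonneg _), ← sq_abs]
    exact pow_le_pow_left₀ (abs_nonneg _) (Complex.abs_re_le_norm _) 2
  have him (i : Fin n) : Integrable (fun x => (φ x i).im) μX := by
    refine integrable_of_integrable_sq (by fun_prop) ((hL2 i).mono' (by fun_prop) ?_)
    refine ae_of_all _ fun x => ?_
    rw [Real.norm_of_nonneg (sq_nonneg _), ← sq_abs]
    exact pow_le_pow_left₀ (abs_nonneg _) (Complex.abs_im_le_norm _) 2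
  have hsingle (i : Fin n) (c : ℂ) (z : Fin n → ℂ) :
      ∑ j, (((Pi.single i c : Fin n → ℂ) j).re * (z j).re +
        ((Pi.single i c : Fin n → ℂ) j).im * (z j).im) = c.re * (z i).re + c.im * (z i).im := by
    rw [Finset.sum_eq_single i]
    · simp
    · intro j _ hj
      simp [hj]
    · simp
  have hzi (i : Fin n) (c : ℂ) :
      Integrable (fun z : Fin n → ℂ => c.re * (z i).re + c.im * (z i).im)
        (circularGaussianVec n 1) := by
    simpa only [hsingle] using integrable_linear_circularGaussianVec 1 (Pi.single i c)
  have hz0 (i : Fin n) (c : ℂ) :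
      ∫ z : Fin n → ℂ, (c.re * (z i).re + c.im * (z i).im) ∂circularGaussianVec n 1 = 0 := by
    simpa only [hsingle] using integral_linear_circularGaussianVec 1 (Pi.single i c)
  have hzre (i : Fin n) := by simpa using hzi i 1
  have hzim (i : Fin n) := by simpa using hzi i Complex.I
  have hz0re (i : Fin n) := by simpa using hz0 i 1
  have hz0im (i : Fin n) := by simpa using hz0 i Complex.I
  have hexp (p : α × (Fin n → ℂ)) : shiftLogDensity (φ p.1) (φ p.1 + p.2) =
      ∑ i, (‖φ p.1 i‖ ^ 2 + 2 * ((φ p.1 i).re * (p.2 i).re + (φ p.1 i).im * (p.2 i).im)) := by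
    rw [shiftLogDensity_add, shiftLogDensity, Finset.mul_sum, ← Finset.sum_add_distrib]
    refine Finset.sum_congr rfl fun i _ => ?_
    rw [Complex.sq_norm, Complex.normSq_apply]
    ring
  have h1 (i : Fin n) : Integrable (fun p : α × (Fin n → ℂ) => ‖φ p.1 i‖ ^ 2)
      (μX.prod (circularGaussianVec n 1)) := (hL2 i).comp_fst _
  have h2 (i : Fin n) : Integrable (fun p : α × (Fin n → ℂ) => (φ p.1 i).re * (p.2 i).re)
      (μX.prod (circularGaussianVec n 1)) := (hre i).mul_prod (hzre i)
  have h3 (i : Fin n) : Integrable (fun p : α × (Fin n → ℂ) => (φ p.1 i).im * (p.2 i).im)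
      (μX.prod (circularGaussianVec n 1)) := (him i).mul_prod (hzim i)
  have h23 (i : Fin n) : Integrable (fun p : α × (Fin n → ℂ) =>
      2 * ((φ p.1 i).re * (p.2 i).re + (φ p.1 i).im * (p.2 i).im))
      (μX.prod (circularGaussianVec n 1)) := ((h2 i).add (h3 i)).const_mul 2
  constructor
  · rw [inputOutputLaw, integrable_map_measure hℓ.aestronglyMeasurable hio.aemeasurable]
    simp only [Function.comp_def, hexp]
    exact integrable_finsetSum _ fun i _ => (h1 i).add (h23 i)
  · rw [inputOutputLaw, integral_map hio.aemeasurable hℓ.aestronglyMeasurable]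
    simp only [hexp]
    refine (integral_finsetSum _ fun i _ => (h1 i).add (h23 i)).trans ?_
    refine Finset.sum_congr rfl fun i _ => (integral_add (h1 i) (h23 i)).trans ?_
    rw [integral_const_mul, integral_add (h2 i) (h3 i),
      integral_prod_mul (fun x => (φ x i).re) (fun z : Fin n → ℂ => (z i).re),
      integral_prod_mul (fun x => (φ x i).im) (fun z : Fin n → ℂ => (z i).im), hz0re, hz0im,
      integral_fun_fst (fun x => ‖φ x i‖ ^ 2)]
    simp

/-- The mutual information is at most the mean energy of the noiseless output. -/
lemma mutualInfo_inputOutputLaw_le [StandardBorelSpace α] [Nonempty α] (μX : Measure α)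
    [IsProbabilityMeasure μX] (hφ : Measurable φ)
    (hL2 : ∀ i, Integrable (fun x => ‖φ x i‖ ^ 2) μX) :
    mutualInfo (inputOutputLaw μX (circularGaussianVec n 1) φ) ≤
      ENNReal.ofReal (∑ i, ∫ x, ‖φ x i‖ ^ 2 ∂μX) := by
  obtain ⟨hint, hval⟩ := integral_shiftLogDensity μX hφ hL2
  have hP := isProbabilityMeasure_inputOutputLaw μX hφ
  -- Against the noise law, unlike the true output law, the joint density is an explicit
  -- exponential.
  refine (mutualInfo_le_klDiv _ (circularGaussianVec n 1)).trans ?_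
  rw [fst_inputOutputLaw μX hφ, ← hval]
  rw [inputOutputLaw_eq_withDensity μX hφ] at hP hint ⊢
  exact (klDiv_withDensity_exp (measurable_shiftLogDensity_comp hφ) hint).le

/-- A lower bound for the mutual information in terms of the correlation of the noiseless outputs
of two independent inputs. -/
lemma le_mutualInfo_inputOutputLaw (μX : Measure α) [IsProbabilityMeasure μX] (hφ : Measurable φ)
    (hL2 : ∀ i, Integrable (fun x => ‖φ x i‖ ^ 2) μX) {C : ℝ} (hC0 : 0 ≤ C)
    (hC : ∫⁻ x, ∫⁻ x', ENNReal.ofReal (Real.exp (2 * ∑ i, ((φ x' i).re * (φ x i).re +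
      (φ x' i).im * (φ x i).im))) ∂μX ∂μX ≤ ENNReal.ofReal C) :
    ENNReal.ofReal (∑ i, ∫ x, ‖φ x i‖ ^ 2 ∂μX - Real.log C) ≤
      mutualInfo (inputOutputLaw μX (circularGaussianVec n 1) φ) := by
  obtain ⟨hint, hval⟩ := integral_shiftLogDensity μX hφ hL2
  have hP := isProbabilityMeasure_inputOutputLaw μX hφ
  have hℓ := measurable_shiftLogDensity_comp hφ
  have hio := measurable_input_output hφ
  have hE := hℓ.exp.ennreal_ofReal
  -- Under the product of marginals the output is `φ x' + z` with `x'` independent of `x`.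
  -- Integrating out `z` gives mass one and leaves the correlation of `φ x` and `φ x'`.
  have hexp : ∫⁻ p, ENNReal.ofReal (Real.exp (shiftLogDensity (φ p.1) p.2))
      ∂((inputOutputLaw μX (circularGaussianVec n 1) φ).fst.prod
        (inputOutputLaw μX (circularGaussianVec n 1) φ).snd) ≤ ENNReal.ofReal C := by
    refine le_trans (le_of_eq ?_) hC
    rw [fst_inputOutputLaw μX hφ, lintegral_prod _ hE.aemeasurable]
    refine lintegral_congr fun x => ?_
    have hℓx : Measurable fun y => shiftLogDensity (φ x) y := hℓ.comp measurable_prodMk_left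
    have hm : Measurable fun p : α × (Fin n → ℂ) => φ p.1 + p.2 := measurable_snd.comp hio
    have hEx := hℓx.exp.ennreal_ofReal
    rw [Measure.snd, inputOutputLaw, Measure.map_map measurable_snd hio,
      lintegral_map hEx (measurable_snd.comp hio)]
    refine (lintegral_prod _ (hEx.comp hm).aemeasurable).trans ?_
    simp only [Function.comp_def]
    refine lintegral_congr fun x' => ?_
    simp_rw [shiftLogDensity_add, Real.exp_add, ENNReal.ofReal_mul (Real.exp_pos _).le]
    rw [lintegral_const_mul' _ _ ENNReal.ofReal_ne_top, lintegral_exp_shiftLogDensity, mul_one]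
  have hpos (p : α × (Fin n → ℂ)) : 0 ≤ Real.exp (shiftLogDensity (φ p.1) p.2) :=
    (Real.exp_pos _).le
  rw [← hval, mutualInfo]
  refine le_klDiv_of_integral_exp_le hint ⟨hℓ.exp.aestronglyMeasurable, ?_⟩ ?_
  · rw [hasFiniteIntegral_iff_ofReal (ae_of_all _ hpos)]
    exact hexp.trans_lt ENNReal.ofReal_lt_top
  · rw [integral_eq_lintegral_of_nonneg_ae (ae_of_all _ hpos) hℓ.exp.aestronglyMeasurable]
    exact ENNReal.toReal_le_of_le_ofReal hC0 hexp

end Channel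

/-! ### Rates of the fading channels -/

section Rates

open InformationTheory

variable {nr nt : ℕ}

/-- The sum of the squared moduli of the entries of a matrix. -/
noncomputable def frobeniusSq (H : Fin nr → Fin nt → ℂ) : ℝ := ∑ i, ∑ j, ‖H i j‖ ^ 2

lemma frobeniusSq_nonneg (H : Fin nr → Fin nt → ℂ) : 0 ≤ frobeniusSq H := by
  unfold frobeniusSq
  positivity

lemma norm_sq_sum_mul_le {ι : Type*} (s : Finset ι) (u w : ι → ℂ) :
    ‖∑ i ∈ s, u i * w i‖ ^ 2 ≤ (∑ i ∈ s, ‖u i‖ ^ 2) * ∑ i ∈ s, ‖w i‖ ^ 2 := by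
  calc ‖∑ i ∈ s, u i * w i‖ ^ 2 ≤ (∑ i ∈ s, ‖u i‖ * ‖w i‖) ^ 2 := by
        gcongr
        exact (norm_sum_le _ _).trans_eq (Finset.sum_congr rfl fun i _ => norm_mul _ _)
    _ ≤ _ := Finset.sum_mul_sq_le_sq_mul_sq _ _ _

lemma mulVec_apply_eq (H : Fin nr → Fin nt → ℂ) (x : Fin nt → ℂ) (i : Fin nr) :
    (Matrix.of H).mulVec x i = ∑ j, H i j * x j := rfl

lemma measurable_mulVec (H : Fin nr → Fin nt → ℂ) : Measurable (Matrix.of H).mulVec := by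
  refine measurable_pi_lambda _ fun i => ?_
  simp only [mulVec_apply_eq]
  fun_prop

lemma sum_norm_sq_mulVec_le (H : Fin nr → Fin nt → ℂ) (x : Fin nt → ℂ) :
    ∑ i, ‖(Matrix.of H).mulVec x i‖ ^ 2 ≤ frobeniusSq H * ∑ j, ‖x j‖ ^ 2 := by
  rw [frobeniusSq, Finset.sum_mul]
  exact Finset.sum_le_sum fun i _ => norm_sq_sum_mul_le _ _ _

lemma integral_norm_sq_mulVec (v : ℝ≥0) (H : Fin nr → Fin nt → ℂ) (i : Fin nr) :
    Integrable (fun x => ‖(Matrix.of H).mulVec x i‖ ^ 2) (circularGaussianVec nt v) ∧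
      ∫ x, ‖(Matrix.of H).mulVec x i‖ ^ 2 ∂circularGaussianVec nt v =
        v * ∑ j, ‖H i j‖ ^ 2 := by
  -- `c` and `d` represent the real and imaginary parts of the `i`-th output as real linear
  -- functionals; each contributes half of the energy.
  set c : Fin nt → ℂ := fun j => ⟨(H i j).re, -(H i j).im⟩ with hc
  set d : Fin nt → ℂ := fun j => ⟨(H i j).im, (H i j).re⟩ with hd
  have hcn (j : Fin nt) : ‖c j‖ ^ 2 = ‖H i j‖ ^ 2 := by
    simp only [hc, Complex.sq_norm, Complex.normSq_apply]
    ring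
  have hdn (j : Fin nt) : ‖d j‖ ^ 2 = ‖H i j‖ ^ 2 := by
    simp only [hd, Complex.sq_norm, Complex.normSq_apply]
    ring
  have h (x : Fin nt → ℂ) : ‖(Matrix.of H).mulVec x i‖ ^ 2 =
      (∑ j, ((c j).re * (x j).re + (c j).im * (x j).im)) ^ 2 +
        (∑ j, ((d j).re * (x j).re + (d j).im * (x j).im)) ^ 2 := by
    rw [mulVec_apply_eq, Complex.sq_norm, Complex.normSq_apply, Complex.re_sum, Complex.im_sum,
      ← sq, ← sq]
    congr 2
    · exact Finset.sum_congr rfl fun j _ => by simp only [hc, Complex.mul_re]; ring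
    · exact Finset.sum_congr rfl fun j _ => by simp only [hd, Complex.mul_im]; ring
  have h1 := integrable_linear_sq_circularGaussianVec v c
  have h2 := integrable_linear_sq_circularGaussianVec v d
  simp_rw [h]
  refine ⟨h1.add h2, ?_⟩
  rw [integral_add h1 h2, integral_linear_sq_circularGaussianVec,
    integral_linear_sq_circularGaussianVec]
  simp_rw [hcn, hdn]
  ring

lemma lintegral_exp_sum_norm_sq {v : ℝ≥0} (hv : v ≠ 0) {t : ℝ} (ht : t * v < 1) :
    ∫⁻ x : Fin nt → ℂ, ENNReal.ofReal (Real.exp (t * ∑ j, ‖x j‖ ^ 2)) ∂circularGaussianVec nt v =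
      ENNReal.ofReal ((1 / (1 - t * v)) ^ nt) := by
  have h (x : Fin nt → ℂ) : ENNReal.ofReal (Real.exp (t * ∑ j, ‖x j‖ ^ 2)) =
      ∏ j, ENNReal.ofReal (Real.exp (t * ‖x j‖ ^ 2)) := by
    rw [← ENNReal.ofReal_prod_of_nonneg fun i _ => (Real.exp_pos _).le, ← Real.exp_sum,
      Finset.mul_sum]
  simp_rw [h]
  rw [circularGaussianVec, lintegral_pi_prod (fun _ => circularGaussian v)
    (f := fun _ z => ENNReal.ofReal (Real.exp (t * ‖z‖ ^ 2))) (fun _ => by fun_prop),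
    lintegral_exp_mul_normSq_circularGaussian hv ht, Finset.prod_const, Finset.card_univ,
    Fintype.card_fin, ENNReal.ofReal_pow (by have := sub_pos.2 ht; positivity)]

/-- The exponential correlation of the noiseless outputs of two independent inputs. -/
lemma lintegral_exp_correlation_le {v : ℝ≥0} (hv : v ≠ 0) (H : Fin nr → Fin nt → ℂ)
    (ht : (v * frobeniusSq H) ^ 2 < 1) :
    ∫⁻ x, ∫⁻ x', ENNReal.ofReal (Real.exp (2 * ∑ i,
      (((Matrix.of H).mulVec x' i).re * ((Matrix.of H).mulVec x i).re +
        ((Matrix.of H).mulVec x' i).im * ((Matrix.of H).mulVec x i).im)))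
      ∂circularGaussianVec nt v ∂circularGaussianVec nt v ≤
      ENNReal.ofReal ((1 / (1 - (v * frobeniusSq H) ^ 2)) ^ nt) := by
  -- The inner Gaussian integral will be at most `exp (t * ∑ j, ‖x j‖ ^ 2)` with `t = v *
  -- frobeniusSq H ^ 2`.
  have he : (v * frobeniusSq H) ^ 2 = v * frobeniusSq H ^ 2 * v := by ring
  rw [he] at ht ⊢
  rw [← lintegral_exp_sum_norm_sq hv ht]
  refine lintegral_mono fun x => ?_
  set w := (Matrix.of H).mulVec x with hw
  -- For fixed `x` the exponent is a real linear functional of `x'` with coefficient vector `2 H* H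
  -- x`.
  set c : Fin nt → ℂ := fun j => 2 * ∑ i, (starRingEnd ℂ) (H i j) * w i with hc
  have h (x' : Fin nt → ℂ) : 2 * ∑ i, (((Matrix.of H).mulVec x' i).re * (w i).re +
      ((Matrix.of H).mulVec x' i).im * (w i).im) =
      ∑ j, ((c j).re * (x' j).re + (c j).im * (x' j).im) := by
    simp only [mulVec_apply_eq, hc, Complex.re_sum, Complex.im_sum, Finset.mul_sum,
      Finset.sum_mul, ← Finset.sum_add_distrib]
    rw [Finset.sum_comm]
    refine Finset.sum_congr rfl fun j _ => Finset.sum_congr rfl fun i _ => ?_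
    simp only [Complex.mul_re, Complex.mul_im, Complex.conj_re, Complex.conj_im, Complex.re_ofNat,
      Complex.im_ofNat]
    ring
  simp_rw [h]
  rw [lintegral_exp_linear_circularGaussianVec]
  refine ENNReal.ofReal_le_ofReal (Real.exp_le_exp.2 ?_)
  have hcj (j : Fin nt) : ‖c j‖ ^ 2 ≤ 4 * ((∑ i, ‖H i j‖ ^ 2) * ∑ i, ‖w i‖ ^ 2) := by
    rw [hc, norm_mul, mul_pow]
    have h4 : ‖(2 : ℂ)‖ ^ 2 = 4 := by norm_num
    rw [h4]
    refine mul_le_mul_of_nonneg_left ?_ (by norm_num)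
    refine (norm_sq_sum_mul_le _ _ _).trans_eq ?_
    simp
  have hfro : ∑ j, ∑ i, ‖H i j‖ ^ 2 = frobeniusSq H := Finset.sum_comm
  calc (v : ℝ) / 4 * ∑ j, ‖c j‖ ^ 2
      ≤ v / 4 * ∑ j, 4 * ((∑ i, ‖H i j‖ ^ 2) * ∑ i, ‖w i‖ ^ 2) :=
        mul_le_mul_of_nonneg_left (Finset.sum_le_sum fun j _ => hcj j) (by positivity)
    _ = v * (frobeniusSq H * ∑ i, ‖w i‖ ^ 2) := by
        rw [← Finset.mul_sum, ← Finset.sum_mul, hfro]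
        ring
    _ ≤ v * (frobeniusSq H * (frobeniusSq H * ∑ j, ‖x j‖ ^ 2)) := by
        have := sum_norm_sq_mulVec_le H x
        have := frobeniusSq_nonneg H
        gcongr
    _ = _ := by ring

/-- The rate of the multiple-antenna channel is asymptotically linear in the power. -/
lemma isLowPowerRate_mimoRate (hnt : 1 ≤ nt) :
    IsLowPowerRate (mimoRate (nr := nr) (nt := nt)) fun H => 1 / nt * frobeniusSq H := by
  have hnt0 : (0 : ℝ) < nt := by exact_mod_cast hnt
  have hT (γ : ℝ≥0) (H : Fin nr → Fin nt → ℂ) :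
      ∑ i, ∫ x, ‖(Matrix.of H).mulVec x i‖ ^ 2 ∂circularGaussianVec nt (γ / nt) =
        γ * (1 / nt * frobeniusSq H) := by
    simp_rw [(integral_norm_sq_mulVec _ H _).2]
    rw [← Finset.mul_sum, frobeniusSq]
    push_cast
    ring
  -- With `t` the mean received energy, the loss is `nt * log (1 / (1 - t ^ 2))`. For `t ≤ 1 / 2`
  -- the logarithm is at most `t ^ 2 / (1 - t ^ 2) ≤ 2 * t ^ 2`, whence `C = 2 * nt` and `δ = 1 /
  -- 2`.
  refine ⟨?_, fun H => mul_nonneg (by positivity) (frobeniusSq_nonneg H), fun γ _ H => ?_,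
    2 * nt, 1 / 2, by norm_num, fun γ hγ H ht => ?_⟩
  · unfold frobeniusSq
    fun_prop
  · rw [← hT]
    exact mutualInfo_inputOutputLaw_le _ (measurable_mulVec H)
      fun i => (integral_norm_sq_mulVec _ H i).1
  · have hv : γ / nt ≠ 0 := div_ne_zero hγ.ne' (by exact_mod_cast hnt0.ne')
    have ht0 : 0 ≤ γ * (1 / nt * frobeniusSq H) :=
      mul_nonneg γ.2 (mul_nonneg (by positivity) (frobeniusSq_nonneg H))
    have htv : ((γ / nt : ℝ≥0) : ℝ) * frobeniusSq H = γ * (1 / nt * frobeniusSq H) := by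
      push_cast
      ring
    have hC := lintegral_exp_correlation_le hv H
    rw [htv] at hC
    have hL2 := fun i => (integral_norm_sq_mulVec (γ / nt) H i).1
    have h := fun hC0 hlt => le_mutualInfo_inputOutputLaw (circularGaussianVec nt (γ / nt))
      (measurable_mulVec H) hL2 hC0 (hC hlt)
    rw [hT] at h
    generalize (γ : ℝ) * (1 / nt * frobeniusSq H) = t at ht ht0 h
    have ht1 : t ^ 2 ≤ 1 / 2 := by nlinarith
    have hd : 0 < 1 - t ^ 2 := by linarith
    refine le_trans (ENNReal.ofReal_le_ofReal ?_) (h (by positivity) (by linarith))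
    have hlog : Real.log (1 / (1 - t ^ 2)) ≤ 2 * t ^ 2 := by
      refine (Real.log_le_sub_one_of_pos (by positivity)).trans ?_
      rw [sub_le_iff_le_add, div_le_iff₀ hd]
      nlinarith [mul_nonneg (sq_nonneg t) (sub_nonneg.2 ht1)]
    rw [Real.log_pow]
    have := mul_le_mul_of_nonneg_left hlog hnt0.le
    linarith

/-- The law of the sum of the squared moduli of the entries of a white Rayleigh fading matrix. -/
lemma map_frobeniusSq_whiteRayleigh (hnr : 1 ≤ nr) (hnt : 1 ≤ nt) :
    (whiteRayleigh nr nt).map (fun H => 1 / nt * frobeniusSq H) =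
      gammaMeasure (nr * nt) nt := by
  have hnt0 : (0 : ℝ) < nt := by exact_mod_cast hnt
  have hnr0 : (0 : ℝ) < nr := by exact_mod_cast hnr
  have : Nonempty (Fin nt) := ⟨⟨0, hnt⟩⟩
  have : Nonempty (Fin nr) := ⟨⟨0, hnr⟩⟩
  have h1 : (circularGaussian 1).map (fun z => ‖z‖ ^ 2) = gammaMeasure 1 1 := by
    simpa using map_normSq_circularGaussian one_ne_zero
  have h2 := map_sum_pi_eq_gammaMeasure (ι := Fin nt) (by fun_prop) one_pos one_pos h1
  have h3 := map_sum_pi_eq_gammaMeasure (ι := Fin nr) (by fun_prop) (by positivity) one_pos h2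
  have hm : Measurable fun H : Fin nr → Fin nt → ℂ => ∑ i, ∑ j, ‖H i j‖ ^ 2 := by fun_prop
  have h4 : (whiteRayleigh nr nt).map (fun H => ∑ i, ∑ j, ‖H i j‖ ^ 2) =
      gammaMeasure (nr * nt) 1 := by
    simpa [whiteRayleigh] using h3
  have h5 := map_const_mul_gammaMeasure (a := nr * nt) (b := 1) (c := 1 / nt) (by positivity)
    one_pos (by positivity)
  rw [← h4, Measure.map_map (by fun_prop) hm, one_div_one_div] at h5
  exact h5

lemma mutualInfo_map_prodCongr {α β α' β' : Type*} [MeasurableSpace α] [MeasurableSpace β]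
    [MeasurableSpace α'] [MeasurableSpace β'] (e : α ≃ᵐ α') (e' : β ≃ᵐ β')
    (P : Measure (α × β)) [IsProbabilityMeasure P] :
    mutualInfo (P.map (e.prodCongr e')) = mutualInfo P := by
  have h1 : (P.map (e.prodCongr e')).fst = P.fst.map e := by
    rw [Measure.fst, Measure.fst, Measure.map_map measurable_fst (MeasurableEquiv.measurable _),
      Measure.map_map e.measurable measurable_fst]
    rfl
  have h2 : (P.map (e.prodCongr e')).snd = P.snd.map e' := by
    rw [Measure.snd, Measure.snd, Measure.map_map measurable_snd (MeasurableEquiv.measurable _),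
      Measure.map_map e'.measurable measurable_snd]
    rfl
  rw [mutualInfo, h1, h2, Measure.map_prod_map _ _ e.measurable e'.measurable]
  exact klDiv_map_measurableEquiv (e.prodCongr e') P _

/-- The scalar channel is the multiple-antenna channel with one antenna at each end. -/
lemma scalarRate_eq_mimoRate (γ : ℝ≥0) (h : ℂ) :
    scalarRate γ h = mimoRate γ fun _ _ : Fin 1 => h := by
  set e : ℂ ≃ᵐ (Fin 1 → ℂ) := (MeasurableEquiv.funUnique (Fin 1) ℂ).symm with he
  have hlaw (v : ℝ≥0) : circularGaussianVec 1 v = (circularGaussian v).map e :=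
    ((measurePreserving_funUnique (circularGaussian v) (Fin 1)).symm _).map_eq.symm
  have hm : Measurable fun p : ℂ × ℂ => (p.1, h * p.1 + p.2) := by fun_prop
  have hP : IsProbabilityMeasure
      (inputOutputLaw (circularGaussian γ) (circularGaussian 1) fun x => h * x) :=
    Measure.isProbabilityMeasure_map hm.aemeasurable
  rw [scalarRate, ← mutualInfo_map_prodCongr e e, mimoRate, Nat.cast_one, div_one]
  congr 1
  rw [inputOutputLaw, inputOutputLaw, hlaw, hlaw, Measure.map_prod_map _ _ e.measurable
    e.measurable, Measure.map_map (MeasurableEquiv.measurable _) hm, Measure.map_map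
    (measurable_input_output (measurable_mulVec _)) (by fun_prop)]
  congr 1
  ext p i
  · rfl
  · simp [he, MeasurableEquiv.prodCongr, mulVec_apply_eq]

/-- The rate of the scalar channel is asymptotically linear in the power. -/
lemma isLowPowerRate_scalarRate : IsLowPowerRate scalarRate fun h => ‖h‖ ^ 2 := by
  have hJ := isLowPowerRate_mimoRate (nr := 1) (nt := 1) le_rfl
  have hg (h : ℂ) : 1 / ((1 : ℕ) : ℝ) * frobeniusSq (fun _ _ : Fin 1 => h) = ‖h‖ ^ 2 := by
    simp [frobeniusSq]
  obtain ⟨C, δ, hδ, hlow⟩ := hJ.lower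
  refine ⟨by fun_prop, fun h => by positivity, fun γ hγ h => ?_, C, δ, hδ, fun γ hγ h ht => ?_⟩
  · rw [scalarRate_eq_mimoRate, ← hg]
    exact hJ.upper γ hγ _
  · rw [← hg] at ht ⊢
    rw [scalarRate_eq_mimoRate]
    exact hlow γ hγ _ ht

end Rates

/-! ### Exponents of the fading models and their comparison with Rayleigh fading. -/

lemma HasOutageExponent.unique {S : Type*} [MeasurableSpace S] {J : ℝ≥0 → S → ℝ≥0∞}
    {ν : Measure S} {η : ℝ} (hη : 0 < η) {e e' : EReal} (h : HasOutageExponent J ν η e)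
    (h' : HasOutageExponent J ν η e') : e = e' := by
  -- For `η > 0` the pair `(η, 1)` realizes the ratio, so the definition is not vacuous and limits
  -- can be compared.
  have hq : ((⟨η, hη.le⟩ : ℝ≥0) : ℝ) / (1 : ℝ≥0) = η := by simp
  exact tendsto_nhds_unique (h ⟨η, hη.le⟩ 1 hη one_pos hq) (h' ⟨η, hη.le⟩ 1 hη one_pos hq)

lemma isNakagami_one_circularGaussian : IsNakagami 1 (circularGaussian 1) := by
  simpa [IsNakagami] using map_normSq_circularGaussian one_ne_zero

lemma hasOutageExponent_scalarRate {m : ℝ} (hm : 0 < m) {ν : Measure ℂ} (hν : IsNakagami m ν)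
    {η : ℝ} (hη : 1 ≤ η) :
    HasOutageExponent scalarRate ν η ((m * (1 / η - 1 + Real.log η) : ℝ) : EReal) := by
  have h := isLowPowerRate_scalarRate.hasOutageExponent hm hm hν (η := η)
    (by rwa [div_self hm.ne'])
  have h1 : m / (m * η) = 1 / η := by field_simp
  have h2 : m * η / m = η := by field_simp
  rwa [h1, h2] at h

lemma hasOutageExponent_rayleigh {η : ℝ} (hη : 1 ≤ η) :
    HasOutageExponent scalarRate (circularGaussian 1) η ((1 / η - 1 + Real.log η : ℝ) : EReal) := by
  simpa only [one_mul] using hasOutageExponent_scalarRate one_pos isNakagami_one_circularGaussian hη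

/-- Here the shape is `a = nr * nt` and the rate is `b = nt`, so the threshold `b / a` is `1 / nr`.
-/
lemma hasOutageExponent_mimoRate {nr nt : ℕ} (hnr : 1 ≤ nr) (hnt : 1 ≤ nt) {η : ℝ}
    (hη : 1 / (nr : ℝ) ≤ η) :
    HasOutageExponent mimoRate (whiteRayleigh nr nt) η
      (((nt : ℝ) * nr * (1 / (nr * η) - 1 + Real.log (nr * η)) : ℝ) : EReal) := by
  have hnt0 : (0 : ℝ) < nt := by exact_mod_cast hnt
  have hnr0 : (0 : ℝ) < nr := by exact_mod_cast hnr
  have h := (isLowPowerRate_mimoRate hnt).hasOutageExponent (by positivity) hnt0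
    (map_frobeniusSq_whiteRayleigh hnr hnt) (η := η) (by convert hη using 1; field_simp)
  have h1 : nt / (nr * nt * η) = 1 / (nr * η) := by field_simp
  have h2 : nr * nt * η / nt = nr * η := by field_simp
  rwa [h1, h2, mul_comm (nr : ℝ) nt] at h


theorem mainTheorem6 :
    -- Nakagami-`m` fading: minimum energy per nat, exponent, and `m` times the Rayleigh exponent
    (∀ m : ℝ, 1 / 2 ≤ m → ∀ ν : Measure ℂ, IsNakagami m ν →
      HasMinEnergyPerNat scalarRate ν 1 ∧
      ∀ η : ℝ, 1 ≤ η →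
        HasOutageExponent scalarRate ν η ((m * (1 / η - 1 + Real.log η) : ℝ) : EReal) ∧
        ∀ e : EReal, HasOutageExponent scalarRate (circularGaussian 1) η e →
          HasOutageExponent scalarRate ν η ((m : EReal) * e)) ∧
    -- Rayleigh fading is the case `m = 1`
    IsNakagami 1 (circularGaussian 1) ∧
    (∀ η : ℝ, 1 ≤ η →
      HasOutageExponent scalarRate (circularGaussian 1) η
        ((1 / η - 1 + Real.log η : ℝ) : EReal)) ∧
    -- spatially white Rayleigh fading with several antennas and spatially white inputs
    (∀ nr nt : ℕ, 1 ≤ nr → 1 ≤ nt →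
      HasMinEnergyPerNat mimoRate (whiteRayleigh nr nt) (nr : ℝ≥0∞)⁻¹ ∧
      ∀ η : ℝ, 1 / (nr : ℝ) ≤ η →
        HasOutageExponent mimoRate (whiteRayleigh nr nt) η
          (((nt : ℝ) * nr * (1 / (nr * η) - 1 + Real.log (nr * η)) : ℝ) : EReal) ∧
        ∀ e : EReal, HasOutageExponent scalarRate (circularGaussian 1) (nr * η) e →
          HasOutageExponent mimoRate (whiteRayleigh nr nt) η (((nt : ℝ) * nr : ℝ) * e)) := by
  refine ⟨fun m hm ν hν => ⟨?_, fun η hη => ⟨?_, fun e he => ?_⟩⟩,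
    isNakagami_one_circularGaussian, fun η hη => hasOutageExponent_rayleigh hη,
    fun nr nt hnr hnt => ⟨?_, fun η hη => ⟨?_, fun e he => ?_⟩⟩⟩
  · have hm0 : 0 < m := by linarith
    simpa [hm0.ne'] using isLowPowerRate_scalarRate.hasMinEnergyPerNat hm0 hm0 hν
  · exact hasOutageExponent_scalarRate (by linarith) hν hη
  · rw [HasOutageExponent.unique (by linarith) he (hasOutageExponent_rayleigh hη),
      ← EReal.coe_mul]
    exact hasOutageExponent_scalarRate (by linarith) hν hη
  · have hnt0 : (0 : ℝ) < nt := by exact_mod_cast hnt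
    have hnr0 : (0 : ℝ) < nr := by exact_mod_cast hnr
    have h := (isLowPowerRate_mimoRate hnt).hasMinEnergyPerNat (by positivity) hnt0
      (map_frobeniusSq_whiteRayleigh hnr hnt)
    rwa [mul_div_cancel_right₀ _ hnt0.ne', ENNReal.ofReal_natCast] at h
  · exact hasOutageExponent_mimoRate hnr hnt hη
  · have hnr0 : (0 : ℝ) < nr := by exact_mod_cast hnr
    have hη1 : 1 ≤ nr * η := by rwa [div_le_iff₀' hnr0] at hη
    rw [HasOutageExponent.unique (by linarith) he (hasOutageExponent_rayleigh hη1),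
      ← EReal.coe_mul]
    exact hasOutageExponent_mimoRate hnr hnt hη
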